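/- Let $n\ge 3$. A complex line $\ell\subset\mathbb C^n$ is called tangent to the sphere with center $c\in\mathbb R^n$ and radius $r$ if $\ell$ contains a point $x$ of the complexified sphere $(x-c)\cdot(x-c)=r^2$ such that $v\cdot(x-c)=0$ for every direction vector $v$ of $\ell$; here $\cdot$ is the bilinear extension of the Euclidean dot product. A complex line is real if it is the complexification of a line in $\mathbb R^n$. (1) General spheres. There is a nonzero real polynomial $P$ in the coordinates of the centers and the radii of $2n-2$ spheres in $\mathbb R^n$ such that any $2n-2$ spheres (of positive radii) at which $P$ does not vanish have exactly $3\cdot 2^{n-1}$ complex common tangent lines. Moreover, among the configurations of $2n-2$ spheres in $\mathbb R^n$ with $P\neq 0$ there is one all of whose complex common tangent lines are real. (2) An explicit family. For real $a,r$ consider the $2n-2$ spheres of equal radius $r$ with centers $$(1,1,1,0,\dots,0),\quad (1,-1,-1,0,\dots,0),\quad (-1,1,-1,0,\dots,0),\quad (-1,-1,1,0,\dots,0),$$ and $\pm a e_j$ for $j=4,\dots,n$, where $e_1,\dots,e_n$ is the standard basis. (As only $r^2$ enters the definition of tangency, the sign of $r$ is irrelevant.) For $a\ne0$ put $\gamma=a^2(n-1)/(a^2+n-3)$.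 If $$a\,r\,(r^2-3)\,(3-\gamma)\,(a^2-2)\,(r^2-\gamma)\,\bigl((3-\gamma)^2+4\gamma-4r^2\bigr)\neq 0,$$ then there are exactly $3\cdot 2^{n-1}$ complex lines tangent to all these spheres. (3) Reality. If $a\neq 0$ and (a) $\tfrac14(3-\gamma)^2+\gamma>r^2>\gamma$, and (b) $\frac{n-1}{n-4}+2>a^2>2$ (for $n=4$ this is read as $a^2>2$; for $n=3$, where the spheres do not depend on $a$, condition (b) is void), then there are exactly $3\cdot 2^{n-1}$ complex lines tangent to all the spheres in (2), and all of them are real. For every $n\ge3$ there are $a,r>0$ satisfying (a) and (b). -/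

import Mathlib

namespace SphereTangents

/-- A complex affine line in `ℂⁿ`: an affine subspace whose direction is one-dimensional
(the empty affine subspace has direction `⊥`, so it is excluded). -/
def IsLine {n : ℕ} (l : AffineSubspace ℂ (Fin n → ℂ)) : Prop :=
  Module.finrank ℂ l.direction = 1

/-- The complexification of a real vector. -/
def complexify {n : ℕ} (x : Fin n → ℝ) : Fin n → ℂ := fun k => (x k : ℂ)

/-- The line `l` is tangent to the complexified sphere `(x - c) ⬝ (x - c) = r ^ 2`: it passes
through a point `x` of that quadric and lies in the tangent hyperplane
`x + {v | v ⬝ (x - c) = 0}` there. The product is the bilinear (not the Hermitian) one. -/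
def IsTangentTo {n : ℕ} (l : AffineSubspace ℂ (Fin n → ℂ)) (c : Fin n → ℝ) (r : ℝ) : Prop :=
  ∃ x ∈ l, (x - complexify c) ⬝ᵥ (x - complexify c) = (r : ℂ) ^ 2 ∧
    ∀ v ∈ l.direction, v ⬝ᵥ (x - complexify c) = 0

/-- The set of complex lines tangent to all the spheres with centers `c i` and radii `r i`. -/
def commonTangents {n : ℕ} {ι : Type*} (c : ι → Fin n → ℝ) (r : ι → ℝ) :
    Set (AffineSubspace ℂ (Fin n → ℂ)) :=
  {l | IsLine l ∧ ∀ i, IsTangentTo l (c i) (r i)}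

/-- A complex line is real if it is the complexification of a line `p + ℝ v` of `ℝⁿ`. -/
def IsRealLine {n : ℕ} (l : AffineSubspace ℂ (Fin n → ℂ)) : Prop :=
  ∃ p v : Fin n → ℝ, v ≠ 0 ∧
    l = AffineSubspace.mk' (complexify p) (Submodule.span ℂ {complexify v})

/-- The coordinates of a configuration of spheres: all the coordinates of the centers, followed
by the radii. -/
def coords {n : ℕ} {ι : Type*} (c : ι → Fin n → ℝ) (r : ι → ℝ) : (ι × Fin n) ⊕ ι → ℝ :=
  Sum.elim (fun q => c q.1 q.2) r

/-- Four alternating vertices of the cube `[-1, 1]³`. -/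
def tetrahedron : Fin 4 → Fin 3 → ℝ :=
  ![![1, 1, 1], ![1, -1, -1], ![-1, 1, -1], ![-1, -1, 1]]

/-- Index set of the special configuration: four indices for the vertices of the tetrahedron,
and, for each of the last `n - 3` coordinates, one index for each sign. -/
abbrev SpecialIndex (n : ℕ) : Type := Fin 4 ⊕ ({j : Fin n // 3 ≤ (j : ℕ)} × Bool)

/-- For `n ≥ 3`, the special configuration consists of `2 n - 2` spheres. -/
theorem card_specialIndex (n : ℕ) (hn : 3 ≤ n) :
    Fintype.card (SpecialIndex n) = 2 * n - 2 := by
  obtain ⟨m, rfl⟩ := Nat.exists_eq_add_of_le hn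
  have h : Fintype.card {j : Fin (3 + m) // 3 ≤ (j : ℕ)} = m := by
    refine Eq.trans (Fintype.card_congr (Equiv.ofBijective
      (fun i : Fin m => (⟨Fin.natAdd 3 i, by simp⟩ : {j : Fin (3 + m) // 3 ≤ (j : ℕ)}))
      ⟨fun i j hij => ?_, fun j => ?_⟩)).symm (Fintype.card_fin m)
    · simpa using hij
    · exact ⟨⟨j.1 - 3, by omega⟩, by ext; simp; omega⟩
  simp [h]
  omega

/-- The centers of the special configuration: the vertices of the tetrahedron in the first three
coordinates, and the points `± a e_j` for the remaining coordinates `j`. -/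
noncomputable def specialCenter (n : ℕ) (a : ℝ) : SpecialIndex n → Fin n → ℝ
  | Sum.inl i => fun k => if h : (k : ℕ) < 3 then tetrahedron i ⟨k, h⟩ else 0
  | Sum.inr (j, true) => Pi.single j.1 a
  | Sum.inr (j, false) => Pi.single j.1 (-a)

/-- The common tangents to the spheres of radius `r` around the special centers. -/
def specialTangents (n : ℕ) (a r : ℝ) : Set (AffineSubspace ℂ (Fin n → ℂ)) :=
  commonTangents (specialCenter n a) (fun _ => r)

/-- The quantity `γ = a² (n - 1) / (a² + n - 3)`. -/
noncomputable def gam (n : ℕ) (a : ℝ) : ℝ := a ^ 2 * ((n : ℝ) - 1) / (a ^ 2 + (n : ℝ) - 3)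

/-- The inequalities on `a` and `r` which force all common tangents of the special configuration
to be real. For `n ≥ 5` the last clause says `(n - 1) / (n - 4) + 2 > a ^ 2 > 2`, for `n = 4` (where
the upper bound is read as infinite) it says `a ^ 2 > 2`, and for `n = 3` (where the configuration
does not involve `a`) it is empty. -/
def RealityCondition (n : ℕ) (a r : ℝ) : Prop :=
  a ≠ 0 ∧ (gam n a < r ^ 2 ∧ r ^ 2 < (1 / 4) * (3 - gam n a) ^ 2 + gam n a) ∧
    (4 ≤ n → 2 < a ^ 2 ∧ ((n : ℝ) - 4) * (a ^ 2 - 2) < (n : ℝ) - 1)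

end SphereTangents

/-! A line with non-isotropic direction is described by a direction `v` with `v ⬝ v = 1` and its
foot point `p` with `p ⬝ v = 0`; the pair is unique up to `v ↦ -v`. An isotropic direction of a
common tangent would have the same product with all centers, which is impossible if the centers span
affinely. So common tangents correspond two-to-one to solutions of a polynomial system in `(v, p)`
(`commonTangents_eq_image`, `tangentLine_eq_iff`).

For the special centers, the system forces `p = foot v`, fixes the squares of the tail coordinates
of `v`, and prescribes the elementary symmetric functions `3 - γ`, `r ^ 2 - γ`, `0` of the squares
of the first three coordinates (`mem_tangentPairs_specialData`). Hence one of these three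
coordinates is zero and the squares of the other two are the roots of `T ^ 2 - (3 - γ) T + (r ^ 2 -
γ)`. With `n = m + 3` this gives `3 * 8 * 2 ^ m` pairs, that is `3 * 2 ^ (n - 1)` lines. Under the
reality condition all the prescribed squares are nonnegative reals.

For general spheres, take a special configuration satisfying the reality condition. There are as
many equations as unknowns, and the Jacobian is invertible at every solution
(`fderiv_specialData_ker`), so each solution continues uniquely to nearby configurations. A weighted
homogenization shows that no solution comes in from infinity (`eventually_tangentPairs_subset`). The
count is therefore locally constant, and conjugation, which permutes the solutions, fixes each of
them by local uniqueness. By Chevalley's theorem, having at least `k` solutions either holds or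
fails off a hypersurface; no hypersurface contains an open set of real configurations, so the count
near the special configuration is the generic one (`exists_encard_zeros_eq`). -/

namespace SphereTangents

/-! ### Generic solution counts from Chevalley's theorem -/

section Elimination

open MvPolynomial

/-- The complex zeros of a system of real polynomials in parameters `σ` and unknowns `τ`,
for real values of the parameters. -/
def zeros {σ τ : Type*} (I : Set (MvPolynomial (σ ⊕ τ) ℝ)) (t : σ → ℝ) : Set (τ → ℂ) :=
  {x | ∀ f ∈ I, aeval (Sum.elim (fun s => (t s : ℂ)) x) f = 0}

/-- A constructible subset of the spectrum of a domain which contains the generic point contains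
a nonempty basic open set. -/
theorem exists_basicOpen_subset_of_isConstructible {R : Type*} [CommRing R] [IsDomain R]
    {s : Set (PrimeSpectrum R)} (hs : Topology.IsConstructible s) (h : ⊥ ∈ s) :
    ∃ f : R, f ≠ 0 ∧ ∀ q : PrimeSpectrum R, f ∉ q.asIdeal → q ∈ s := by
  obtain ⟨S, rfl⟩ := PrimeSpectrum.exists_constructibleSetData_iff.mpr hs
  simp only [PrimeSpectrum.ConstructibleSetData.toSet, Set.mem_iUnion] at h
  obtain ⟨C, hC, hg, hf⟩ := h
  have hg0 : ∀ i, C.g i = 0 := by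
    intro i
    simpa using hg ⟨i, rfl⟩
  refine ⟨C.f, by simpa using hf, fun q hq => ?_⟩
  simp only [PrimeSpectrum.ConstructibleSetData.toSet, Set.mem_iUnion]
  refine ⟨C, hC, ?_, by simpa using hq⟩
  rintro _ ⟨i, rfl⟩
  simp [hg0 i]

/-- The prime ideal of polynomials vanishing at a real point. -/
noncomputable def pointIdeal {σ : Type*} (t : σ → ℝ) : PrimeSpectrum (MvPolynomial σ ℝ) :=
  ⟨RingHom.ker (eval t), RingHom.ker_isPrime _⟩

theorem aeval_rename_inl {σ τ : Type*} (t : σ → ℝ) (x : τ → ℂ) (p : MvPolynomial σ ℝ) :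
    aeval (Sum.elim (fun s => (t s : ℂ)) x) (rename (Sum.inl : σ → σ ⊕ τ) p) =
      ((eval t p : ℝ) : ℂ) := by
  rw [aeval_rename, Sum.elim_comp_inl]
  have : (fun s => (t s : ℂ)) = algebraMap ℝ ℂ ∘ t := rfl
  rw [this, aeval_algebraMap_apply]
  simp

/-- The structure map of the coordinate ring of a system of equations over its parameters. -/
noncomputable def parameterHom {σ τ : Type*} (I : Set (MvPolynomial (σ ⊕ τ) ℝ)) :
    MvPolynomial σ ℝ →+* MvPolynomial (σ ⊕ τ) ℝ ⧸ Ideal.span I :=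
  (Ideal.Quotient.mk (Ideal.span I)).comp (rename (Sum.inl : σ → σ ⊕ τ)).toRingHom

/-- This makes solvability a question about the image of a map of spectra. A complex zero gives the
kernel of its evaluation map. Conversely, a prime over the point `t` has a complex zero by the
Nullstellensatz, and it contains all `X s - C (t s)`, so the parameter coordinates of that zero are
those of `t`. -/
theorem zeros_nonempty_iff {σ τ : Type*} [Finite σ] [Finite τ]
    (I : Set (MvPolynomial (σ ⊕ τ) ℝ)) (t : σ → ℝ) :
    (zeros I t).Nonempty ↔ pointIdeal t ∈ Set.range (PrimeSpectrum.comap (parameterHom I)) := by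
  constructor
  · rintro ⟨x, hx⟩
    let φ : MvPolynomial (σ ⊕ τ) ℝ →+* ℂ :=
      (aeval (Sum.elim (fun s => (t s : ℂ)) x)).toRingHom
    have hφ : ∀ a ∈ Ideal.span I, φ a = 0 := by
      have : Ideal.span I ≤ RingHom.ker φ := Ideal.span_le.mpr fun f hf => hx f hf
      exact fun a ha => this ha
    refine ⟨⟨RingHom.ker (Ideal.Quotient.lift _ φ hφ), RingHom.ker_isPrime _⟩, ?_⟩
    ext p
    have := aeval_rename_inl t x p
    simp only [pointIdeal, PrimeSpectrum.comap_asIdeal, Ideal.mem_comap, RingHom.mem_ker,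
      parameterHom, RingHom.comp_apply, Ideal.Quotient.lift_mk]
    change aeval _ (rename _ p) = 0 ↔ _
    rw [this]
    simp
  · rintro ⟨Q, hQ⟩
    let J : Ideal (MvPolynomial (σ ⊕ τ) ℝ) := Q.asIdeal.comap (Ideal.Quotient.mk (Ideal.span I))
    have hJ : J.IsPrime := Ideal.comap_isPrime _ _
    have hne : (zeroLocus ℂ J).Nonempty := by
      by_contra h
      rw [Set.not_nonempty_iff_eq_empty] at h
      have := vanishingIdeal_zeroLocus_eq_radical (K := ℂ) J
      rw [h, vanishingIdeal_empty, hJ.radical] at this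
      exact hJ.ne_top this.symm
    obtain ⟨z, hz⟩ := hne
    have hzt : ∀ s, z (Sum.inl s) = t s := by
      intro s
      have hmem : (X s - C (t s) : MvPolynomial σ ℝ) ∈ (pointIdeal t).asIdeal := by
        simp [pointIdeal, RingHom.mem_ker]
      rw [← hQ] at hmem
      have h := hz (rename Sum.inl (X s - C (t s))) hmem
      simpa [sub_eq_zero] using h
    refine ⟨z ∘ Sum.inr, fun f hf => ?_⟩
    have h := hz f (by
      change Ideal.Quotient.mk _ f ∈ Q.asIdeal
      rw [Ideal.Quotient.eq_zero_iff_mem.mpr (Ideal.subset_span hf)]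
      exact zero_mem _)
    have hz' : Sum.elim (fun s => (t s : ℂ)) (z ∘ Sum.inr) = z := by
      ext i
      rcases i with s | y <;> simp [hzt]
    rw [hz']
    exact h

/-- A system of polynomial equations with parameters is generically solvable or generically
unsolvable. -/
theorem zeros_nonempty_dichotomy {σ τ : Type*} [Finite σ] [Finite τ]
    (I : Set (MvPolynomial (σ ⊕ τ) ℝ)) :
    ∃ P : MvPolynomial σ ℝ, P ≠ 0 ∧ ((∀ t, eval t P ≠ 0 → (zeros I t).Nonempty) ∨
      (∀ t, eval t P ≠ 0 → ¬ (zeros I t).Nonempty)) := by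
  have hfin : (parameterHom I).FinitePresentation := by
    rw [← RingHom.FinitePresentation.of_finiteType]
    have h2 : ((parameterHom I).comp (C : ℝ →+* MvPolynomial σ ℝ)).FiniteType := by
      have : (parameterHom I).comp (C : ℝ →+* MvPolynomial σ ℝ) =
          algebraMap ℝ (MvPolynomial (σ ⊕ τ) ℝ ⧸ Ideal.span I) := by
        ext r
        simp [parameterHom]
        rfl
      rw [this, RingHom.finiteType_algebraMap]
      infer_instance
    exact RingHom.FiniteType.of_comp_finiteType h2
  -- Chevalley's theorem: the range is constructible, so either it or its complement contains the
  -- generic point and with it a basic open set.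
  have hcon := PrimeSpectrum.isConstructible_range_comap hfin
  by_cases hbot : ⊥ ∈ Set.range (PrimeSpectrum.comap (parameterHom I))
  · obtain ⟨P, hP, h⟩ := exists_basicOpen_subset_of_isConstructible hcon hbot
    refine ⟨P, hP, Or.inl fun t ht => (zeros_nonempty_iff I t).mpr (h _ ?_)⟩
    simpa [pointIdeal, RingHom.mem_ker] using ht
  · obtain ⟨P, hP, h⟩ := exists_basicOpen_subset_of_isConstructible
      (Topology.IsConstructible.compl hcon) hbot
    refine ⟨P, hP, Or.inr fun t ht => fun hne => h (pointIdeal t) ?_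
      ((zeros_nonempty_iff I t).mp hne)⟩
    simpa [pointIdeal, RingHom.mem_ker] using ht

/-- The equations for `k` pairwise distinct zeros of a system; the additional unknowns certify
distinctness. -/
noncomputable def distinctZerosSystem {σ τ : Type*} [Fintype τ] (I : Set (MvPolynomial (σ ⊕ τ) ℝ))
    (k : ℕ) : Set (MvPolynomial (σ ⊕ ((Fin k × τ) ⊕ (Fin k × Fin k × τ))) ℝ) :=
  {g | ∃ i : Fin k, ∃ f ∈ I, g = rename (Sum.map id fun y => Sum.inl (i, y)) f} ∪
  {g | ∃ i j : Fin k, i ≠ j ∧ g = ∑ y : τ, X (Sum.inr (Sum.inr (i, j, y))) *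
    (X (Sum.inr (Sum.inl (i, y))) - X (Sum.inr (Sum.inl (j, y)))) - 1}

/-- Rabinowitsch's trick: two points `x`, `y` differ exactly when `w ⬝ (x - y) = 1` for some `w`. So
a lower bound on the number of zeros becomes solvability of another system. -/
theorem distinctZerosSystem_nonempty_iff {σ τ : Type*} [Fintype τ]
    (I : Set (MvPolynomial (σ ⊕ τ) ℝ)) (k : ℕ) (t : σ → ℝ) :
    (zeros (distinctZerosSystem I k) t).Nonempty ↔ (k : ℕ∞) ≤ (zeros I t).encard := by
  have key : ∀ (z : (Fin k × τ) ⊕ (Fin k × Fin k × τ) → ℂ) (i : Fin k)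
      (f : MvPolynomial (σ ⊕ τ) ℝ),
      aeval (Sum.elim (fun s => (t s : ℂ)) z) (rename (Sum.map id fun y => Sum.inl (i, y)) f) =
        aeval (Sum.elim (fun s => (t s : ℂ)) fun y => z (Sum.inl (i, y))) f := by
    intro z i f
    rw [aeval_rename]
    congr 2
    ext a
    rcases a with a | a <;> simp
  constructor
  · rintro ⟨z, hz⟩
    let x : Fin k → τ → ℂ := fun i y => z (Sum.inl (i, y))
    have hx : ∀ i, x i ∈ zeros I t := fun i f hf => by
      rw [← key]
      exact hz _ (Or.inl ⟨i, f, hf, rfl⟩)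
    have hinj : Function.Injective x := by
      intro i j hij
      by_contra hne
      have h := hz _ (Or.inr ⟨i, j, hne, rfl⟩)
      have hij' : ∀ y, z (Sum.inl (i, y)) = z (Sum.inl (j, y)) := fun y => congrFun hij y
      simp [hij'] at h
    have : Set.range x ⊆ zeros I t := by
      rintro _ ⟨i, rfl⟩
      exact hx i
    calc (k : ℕ∞) = (Set.range x).encard := by
          rw [← Set.image_univ, hinj.encard_image]; simp
      _ ≤ _ := Set.encard_le_encard this
  · intro h
    obtain ⟨s, hs, hsk⟩ := Set.exists_subset_encard_eq h
    have hfin : s.Finite := Set.finite_of_encard_eq_coe hsk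
    have hcard : hfin.toFinset.card = k := by
      rw [hfin.encard_eq_coe_toFinset_card] at hsk
      exact_mod_cast hsk
    let e := (hfin.toFinset.equivFinOfCardEq hcard).symm
    let x : Fin k → τ → ℂ := fun i => (e i : τ → ℂ)
    have hx : ∀ i, x i ∈ zeros I t := fun i => hs (hfin.mem_toFinset.mp (e i).2)
    have hinj : Function.Injective x := Subtype.val_injective.comp e.injective
    have hw : ∀ i j : Fin k, ∃ w : τ → ℂ, i ≠ j → ∑ y, w y * (x i y - x j y) = 1 := by
      intro i j
      by_cases hij : i = j
      · exact ⟨0, fun h => absurd hij h⟩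
      · obtain ⟨y, hy⟩ := Function.ne_iff.mp (hinj.ne hij)
        classical
        refine ⟨Pi.single y (x i y - x j y)⁻¹, fun _ => ?_⟩
        rw [Finset.sum_eq_single y]
        · simp [inv_mul_cancel₀ (sub_ne_zero.mpr hy)]
        · intro b _ hb
          simp [hb]
        · simp
    choose w hw using hw
    refine ⟨Sum.elim (fun q => x q.1 q.2) (fun q => w q.1 q.2.1 q.2.2), ?_⟩
    rintro g (⟨i, f, hf, rfl⟩ | ⟨i, j, hij, rfl⟩)
    · rw [key]
      exact hx i f hf
    · simpa [sub_eq_zero] using hw i j hij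

/-- A nonzero real polynomial does not vanish identically near a point. -/
theorem exists_eval_ne_zero_of_eventually {σ : Type*} [Finite σ] {P : MvPolynomial σ ℝ}
    (hP : P ≠ 0) {t₀ : σ → ℝ} {Q : (σ → ℝ) → Prop} (hQ : ∀ᶠ t in nhds t₀, Q t) :
    ∃ t, eval t P ≠ 0 ∧ Q t := by
  have := Fintype.ofFinite σ
  obtain ⟨ε, hε, h⟩ := Metric.eventually_nhds_iff_ball.mp hQ
  by_contra! hcon
  -- Balls of the sup norm are products of intervals, and a polynomial vanishing on a product of
  -- infinite sets is zero.
  refine hP (funext_set (fun i => Metric.ball (t₀ i) ε) (fun i => ?_) fun x hx => ?_)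
  · rw [Real.ball_eq_Ioo]
    exact Set.Ioo_infinite (by linarith)
  · rw [map_zero]
    by_contra hne
    refine hcon x hne (h x ?_)
    rw [ball_pi _ hε]
    exact hx

/-- If a system with parameters has exactly `m` zeros for all parameters near some point, then it
has exactly `m` zeros for generic parameters. -/
theorem exists_encard_zeros_eq {σ τ : Type*} [Finite σ] [Finite τ]
    (I : Set (MvPolynomial (σ ⊕ τ) ℝ)) {m : ℕ} {t₀ : σ → ℝ}
    (h : ∀ᶠ t in nhds t₀, (zeros I t).encard = m) :
    ∃ P : MvPolynomial σ ℝ, P ≠ 0 ∧ ∀ t, eval t P ≠ 0 → (zeros I t).encard = m := by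
  have := Fintype.ofFinite τ
  obtain ⟨P, hP, hP'⟩ := zeros_nonempty_dichotomy (distinctZerosSystem I m)
  obtain ⟨Q, hQ, hQ'⟩ := zeros_nonempty_dichotomy (distinctZerosSystem I (m + 1))
  simp only [distinctZerosSystem_nonempty_iff] at hP' hQ'
  refine ⟨P * Q, mul_ne_zero hP hQ, fun t ht => ?_⟩
  rw [map_mul, mul_ne_zero_iff] at ht
  apply le_antisymm
  · have := (hQ'.resolve_left fun hcon => ?_) t ht.2
    · push_cast at this
      exact Order.le_of_lt_add_one (not_le.mp this)
    · obtain ⟨t, ht, ht'⟩ := exists_eval_ne_zero_of_eventually hQ h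
      have := hcon t ht
      rw [ht'] at this
      norm_cast at this
      omega
  · refine (hP'.resolve_right fun hcon => ?_) t ht.1
    obtain ⟨t, ht, ht'⟩ := exists_eval_ne_zero_of_eventually hP h
    exact hcon t ht ht'.ge

end Elimination

/-! ### Continuation of nondegenerate solutions -/

section LocalConstancy

open Filter Topology

/-- Points of a family of sets which stays near a finite set `Z₀`, with locally exactly one point
near each point of `Z₀`, are as many as those of `Z₀`. -/
theorem eventually_encard_eq {T X : Type*} [TopologicalSpace X] [T2Space X] {l : Filter T}
    {Z : T → Set X} {Z₀ : Set X} (hfin : Z₀.Finite)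
    (hex : ∀ x ∈ Z₀, ∀ W ∈ 𝓝 x, ∀ᶠ t in l, (Z t ∩ W).Nonempty)
    (huniq : ∀ x ∈ Z₀, ∃ W ∈ 𝓝 x, ∀ᶠ t in l, (Z t ∩ W).Subsingleton)
    (hprop : ∀ W, IsOpen W → Z₀ ⊆ W → ∀ᶠ t in l, Z t ⊆ W) :
    ∀ᶠ t in l, (Z t).encard = Z₀.encard := by
  obtain ⟨U, hU, hdisj⟩ := hfin.t2_separation
  choose! W hW hWu using huniq
  let V : X → Set X := fun x => interior (W x) ∩ U x
  have hV : ∀ x ∈ Z₀, x ∈ V x := fun x hx => ⟨mem_interior_iff_mem_nhds.mpr (hW x hx), (hU x).1⟩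
  have hVo : ∀ x, IsOpen (V x) := fun x => isOpen_interior.inter (hU x).2
  have h1 : ∀ᶠ t in l, ∀ x ∈ Z₀, (Z t ∩ W x).Subsingleton :=
    (eventually_all_finite hfin).mpr hWu
  have h2 : ∀ᶠ t in l, ∀ x ∈ Z₀, (Z t ∩ V x).Nonempty :=
    (eventually_all_finite hfin).mpr fun x hx => hex x hx _ ((hVo x).mem_nhds (hV x hx))
  have h3 := hprop (⋃ x ∈ Z₀, V x) (isOpen_biUnion fun x _ => hVo x)
    fun x hx => Set.mem_biUnion hx (hV x hx)
  filter_upwards [h1, h2, h3] with t h1 h2 h3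
  -- The point of `Z t` near `x ∈ Z₀` defines a bijection: injective since the `V x` are disjoint,
  -- surjective since they cover `Z t` and each meets it only once.
  choose! g hg using h2
  have himage : g '' Z₀ = Z t := by
    apply subset_antisymm
    · rintro _ ⟨x, hx, rfl⟩
      exact (hg x hx).1
    · intro z hz
      obtain ⟨x, hx, hzx⟩ := Set.mem_iUnion₂.mp (h3 hz)
      exact ⟨x, hx, h1 x hx ⟨(hg x hx).1, interior_subset (hg x hx).2.1⟩
        ⟨hz, interior_subset hzx.1⟩⟩
  have hinj : Set.InjOn g Z₀ := by
    intro x hx y hy hxy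
    by_contra hne
    refine Set.disjoint_left.mp (hdisj hx hy hne) (hg x hx).2.2 ?_
    rw [hxy]
    exact (hg y hy).2.2
  rw [← himage, hinj.encard_image]

/-- An involution preserving a family of sets which stays near a set `Z₀` of fixed points fixes
these sets pointwise, if there is locally only one point near each point of `Z₀`. -/
theorem eventually_fixed {T X : Type*} [TopologicalSpace X] {l : Filter T}
    {Z : T → Set X} {Z₀ : Set X} {f : X → X} (hf : Continuous f) (hfZ₀ : ∀ x ∈ Z₀, f x = x)
    (hfZ : ∀ t, ∀ x ∈ Z t, f x ∈ Z t) (hfin : Z₀.Finite)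
    (huniq : ∀ x ∈ Z₀, ∃ W ∈ 𝓝 x, ∀ᶠ t in l, (Z t ∩ W).Subsingleton)
    (hprop : ∀ W, IsOpen W → Z₀ ⊆ W → ∀ᶠ t in l, Z t ⊆ W) :
    ∀ᶠ t in l, ∀ x ∈ Z t, f x = x := by
  choose! W hW hWu using huniq
  -- For a point of `Z t` in `V x`, both it and its image lie in `W x`, where `Z t` has at most one
  -- point.
  let V : X → Set X := fun x => interior (W x) ∩ f ⁻¹' interior (W x)
  have hV : ∀ x ∈ Z₀, x ∈ V x := fun x hx => by
    have h := mem_interior_iff_mem_nhds.mpr (hW x hx)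
    exact ⟨h, by simpa [hfZ₀ x hx] using h⟩
  have hVo : ∀ x, IsOpen (V x) := fun x => isOpen_interior.inter (isOpen_interior.preimage hf)
  have h1 : ∀ᶠ t in l, ∀ x ∈ Z₀, (Z t ∩ W x).Subsingleton :=
    (eventually_all_finite hfin).mpr hWu
  have h3 := hprop (⋃ x ∈ Z₀, V x) (isOpen_biUnion fun x _ => hVo x)
    fun x hx => Set.mem_biUnion hx (hV x hx)
  filter_upwards [h1, h3] with t h1 h3 z hz
  obtain ⟨x, hx, hzx⟩ := Set.mem_iUnion₂.mp (h3 hz)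
  exact h1 x hx ⟨hfZ t z hz, interior_subset hzx.2⟩ ⟨hz, interior_subset hzx.1⟩

section InverseFunction

variable {T X Y : Type*} [NormedAddCommGroup T] [NormedSpace ℂ T] [FiniteDimensional ℂ T]
  [NormedAddCommGroup X] [NormedSpace ℂ X] [FiniteDimensional ℂ X]
  [NormedAddCommGroup Y] [NormedSpace ℂ Y] [FiniteDimensional ℂ Y]

/-- The derivative of `(t, x) ↦ (t, F (t, x))` is block triangular, hence injective by `hker` and
bijective by dimension. The inverse function theorem for this map then gives existence of nearby
zeros (openness) and their uniqueness (local left inverse). -/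
theorem exists_hasStrictFDerivAt_graph {F : T × X → Y} {F' : T × X →L[ℂ] Y} {t₀ : T} {x₀ : X}
    (hF : HasStrictFDerivAt F F' (t₀, x₀)) (hrank : Module.finrank ℂ X = Module.finrank ℂ Y)
    (hker : ∀ x, F' (0, x) = 0 → x = 0) :
    ∃ e : (T × X) ≃L[ℂ] (T × Y), HasStrictFDerivAt (fun z : T × X => (z.1, F z))
      (e : (T × X) →L[ℂ] (T × Y)) (t₀, x₀) := by
  let L : (T × X) →L[ℂ] (T × Y) := (ContinuousLinearMap.fst ℂ T X).prod F'
  have hinj : Function.Injective (L : (T × X) →ₗ[ℂ] (T × Y)) := by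
    rw [← LinearMap.ker_eq_bot, LinearMap.ker_eq_bot']
    rintro ⟨t, x⟩ h
    have h1 : t = 0 := congrArg Prod.fst h
    have h2 : F' (t, x) = 0 := congrArg Prod.snd h
    subst h1
    rw [hker x h2]
    rfl
  let e := (LinearEquiv.ofInjectiveOfFinrankEq (L : (T × X) →ₗ[ℂ] (T × Y)) hinj
    (by rw [Module.finrank_prod, Module.finrank_prod, hrank])).toContinuousLinearEquiv
  refine ⟨e, ?_⟩
  have he : (e : (T × X) →L[ℂ] (T × Y)) = L := by
    ext z <;> rfl
  rw [he]
  exact hasStrictFDerivAt_fst.prodMk hF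

theorem eventually_exists_zero {F : T × X → Y} {F' : T × X →L[ℂ] Y} {t₀ : T} {x₀ : X}
    (hF : HasStrictFDerivAt F F' (t₀, x₀)) (hrank : Module.finrank ℂ X = Module.finrank ℂ Y)
    (hker : ∀ x, F' (0, x) = 0 → x = 0) (h₀ : F (t₀, x₀) = 0) {W : Set X} (hW : W ∈ 𝓝 x₀) :
    ∀ᶠ t in 𝓝 t₀, ({x | F (t, x) = 0} ∩ W).Nonempty := by
  have := FiniteDimensional.complete ℂ (T × X)
  obtain ⟨e, he⟩ := exists_hasStrictFDerivAt_graph hF hrank hker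
  have h1 : (Set.univ : Set T) ×ˢ W ∈ 𝓝 (t₀, x₀) := prod_mem_nhds univ_mem hW
  have h2 := image_mem_map (m := fun z : T × X => (z.1, F z)) h1
  rw [he.map_nhds_eq_of_equiv] at h2
  have h3 : Tendsto (fun t : T => (t, (0 : Y))) (𝓝 t₀) (𝓝 (t₀, F (t₀, x₀))) := by
    rw [h₀]
    exact (Continuous.prodMk_left (0 : Y)).tendsto t₀
  filter_upwards [h3 h2] with t ht
  obtain ⟨⟨s, x⟩, ⟨-, hx⟩, hs⟩ := ht
  have hs1 : s = t := congrArg Prod.fst hs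
  have hs2 : F (s, x) = 0 := congrArg Prod.snd hs
  subst hs1
  exact ⟨x, hs2, hx⟩

theorem exists_nhds_eventually_subsingleton {F : T × X → Y} {F' : T × X →L[ℂ] Y} {t₀ : T}
    {x₀ : X} (hF : HasStrictFDerivAt F F' (t₀, x₀))
    (hrank : Module.finrank ℂ X = Module.finrank ℂ Y) (hker : ∀ x, F' (0, x) = 0 → x = 0) :
    ∃ W ∈ 𝓝 x₀, ∀ᶠ t in 𝓝 t₀, ({x | F (t, x) = 0} ∩ W).Subsingleton := by
  have := FiniteDimensional.complete ℂ (T × X)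
  obtain ⟨e, he⟩ := exists_hasStrictFDerivAt_graph hF hrank hker
  have h1 := he.eventually_left_inverse
  rw [nhds_prod_eq, eventually_prod_iff] at h1
  obtain ⟨A, hA, B, hB, hAB⟩ := h1
  refine ⟨{x | B x}, hB, ?_⟩
  filter_upwards [hA] with t ht x hx y hy
  have hx' := hAB ht hx.2
  have hy' := hAB ht hy.2
  have hx0 : F (t, x) = 0 := hx.1
  have hy0 : F (t, y) = 0 := hy.1
  simp only [hx0] at hx'
  simp only [hy0] at hy'
  exact congrArg Prod.snd (hx'.symm.trans hy')

end InverseFunction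

end LocalConstancy

/-! ### The tangency equations and their behaviour at infinity -/

section TangencyEquations

open Filter Topology

variable {n : ℕ} {ι : Type*}

/-- The equations for a direction `v` with `v ⬝ v = 1` and a point `p` with `p ⬝ v = 0` which
express that the line `p + ℂ v` is tangent to the spheres with centers `c i` and squared
radii `R i`; the arguments are `((c, R), (v, p))`. -/
noncomputable def tangencyMap (z : ((ι → Fin n → ℂ) × (ι → ℂ)) × ((Fin n → ℂ) × (Fin n → ℂ))) :
    ℂ × ℂ × (ι → ℂ) :=
  (z.2.1 ⬝ᵥ z.2.1 - 1, z.2.2 ⬝ᵥ z.2.1, fun i => z.2.2 ⬝ᵥ z.2.2 - 2 * (z.2.2 ⬝ᵥ z.1.1 i) +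
    z.1.1 i ⬝ᵥ z.1.1 i - (z.1.1 i ⬝ᵥ z.2.1) ^ 2 - z.1.2 i)

/-- Pairs of a unit direction and a foot point which describe common tangents. -/
def tangentPairs (t : (ι → Fin n → ℂ) × (ι → ℂ)) : Set ((Fin n → ℂ) × (Fin n → ℂ)) :=
  {x | tangencyMap (t, x) = 0}

theorem mem_tangentPairs {t : (ι → Fin n → ℂ) × (ι → ℂ)} {x : (Fin n → ℂ) × (Fin n → ℂ)} :
    x ∈ tangentPairs t ↔ x.1 ⬝ᵥ x.1 = 1 ∧ x.2 ⬝ᵥ x.1 = 0 ∧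
      ∀ i, x.2 ⬝ᵥ x.2 - 2 * (x.2 ⬝ᵥ t.1 i) + t.1 i ⬝ᵥ t.1 i - (t.1 i ⬝ᵥ x.1) ^ 2 = t.2 i := by
  simp [tangentPairs, tangencyMap, Prod.ext_iff, funext_iff, sub_eq_zero]

theorem contDiff_tangencyMap [Fintype ι] : ContDiff ℂ 1 (tangencyMap (n := n) (ι := ι)) := by
  unfold tangencyMap dotProduct
  fun_prop

/-- For fixed `t` the map is quadratic in the unknowns, so on a line `x + s y` it equals its value
at `x` plus `s • L + s ^ 2 • Q`, and the derivative is `L`. -/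
theorem fderiv_tangencyMap_apply [Fintype ι] (t : (ι → Fin n → ℂ) × (ι → ℂ))
    (x y : (Fin n → ℂ) × (Fin n → ℂ)) :
    fderiv ℂ tangencyMap (t, x) (0, y) = (2 * (x.1 ⬝ᵥ y.1), x.2 ⬝ᵥ y.1 + y.2 ⬝ᵥ x.1,
      fun i => 2 * (x.2 ⬝ᵥ y.2) - 2 * (y.2 ⬝ᵥ t.1 i) -
        2 * (t.1 i ⬝ᵥ x.1) * (t.1 i ⬝ᵥ y.1)) := by
  set L : ℂ × ℂ × (ι → ℂ) := (2 * (x.1 ⬝ᵥ y.1), x.2 ⬝ᵥ y.1 + y.2 ⬝ᵥ x.1,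
      fun i => 2 * (x.2 ⬝ᵥ y.2) - 2 * (y.2 ⬝ᵥ t.1 i) -
        2 * (t.1 i ⬝ᵥ x.1) * (t.1 i ⬝ᵥ y.1)) with hL
  set Q : ℂ × ℂ × (ι → ℂ) := (y.1 ⬝ᵥ y.1, y.2 ⬝ᵥ y.1,
      fun i => y.2 ⬝ᵥ y.2 - (t.1 i ⬝ᵥ y.1) ^ 2) with hQ
  have hexp : ∀ s : ℂ, tangencyMap (t, x + s • y) =
      tangencyMap (t, x) + (s • L + s ^ 2 • Q) := by
    intro s
    simp only [tangencyMap, hL, hQ, Prod.fst_add, Prod.snd_add, Prod.smul_fst, Prod.smul_snd,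
      dotProduct_add, add_dotProduct, dotProduct_smul, smul_dotProduct, smul_eq_mul]
    refine Prod.ext ?_ (Prod.ext ?_ (funext fun i => ?_))
    · simp [dotProduct_comm y.1 x.1]
      ring
    · simp
      ring
    · simp [dotProduct_comm y.2 x.2]
      ring
  have h1 : HasDerivAt (fun s : ℂ => tangencyMap (t, x + s • y)) L 0 := by
    simp_rw [hexp]
    have := (((hasDerivAt_id (0 : ℂ)).smul_const L).add
      (((hasDerivAt_id (0 : ℂ)).pow 2).smul_const Q)).const_add (tangencyMap (t, x))
    simpa using this
  have h2 : HasDerivAt (fun s : ℂ => (t, x + s • y)) ((0 : (ι → Fin n → ℂ) × (ι → ℂ)), y) 0 := by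
    have := ((hasDerivAt_id (0 : ℂ)).smul_const y).const_add x
    simp only [one_smul] at this
    exact (hasDerivAt_const _ _).prodMk this
  have h3 : HasFDerivAt tangencyMap (fderiv ℂ (tangencyMap (n := n) (ι := ι)) (t, x))
      (t, x + (0 : ℂ) • y) := by
    rw [zero_smul, add_zero]
    exact (contDiff_tangencyMap.differentiable (by norm_num) _).hasFDerivAt
  have h4 : HasDerivAt (fun s : ℂ => tangencyMap (t, x + s • y))
      (fderiv ℂ tangencyMap (t, x) (0, y)) 0 := by
    have := HasFDerivAt.comp_hasDerivAt (l := tangencyMap) (0 : ℂ) h3 h2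
    exact this
  exact h4.unique h1

/-- No tangents of a configuration escape to infinity: the leading forms of the equations have
no common zero. -/
def NoTangentsAtInfinity (c : ι → Fin n → ℂ) : Prop :=
  ∀ (u q : Fin n → ℂ) (e : ℂ), u ⬝ᵥ u = 0 → q ⬝ᵥ u = 0 → q ⬝ᵥ q = 0 →
    (∀ i, 2 * (q ⬝ᵥ c i) + (c i ⬝ᵥ u) ^ 2 = e) → u = 0 ∧ q = 0

/-- Weighted homogenization of the tangency equations. -/
def HomogeneousTangency (i₀ : ι) (t : (ι → Fin n → ℂ) × (ι → ℂ))
    (k : ℝ × (Fin n → ℂ) × (Fin n → ℂ)) : Prop :=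
  k.2.1 ⬝ᵥ k.2.1 = (k.1 : ℂ) ^ 2 ∧ k.2.2 ⬝ᵥ k.2.1 = 0 ∧
    ∀ i, 2 * (k.2.2 ⬝ᵥ t.1 i) + (t.1 i ⬝ᵥ k.2.1) ^ 2 +
      (k.1 : ℂ) ^ 2 * (t.2 i - t.1 i ⬝ᵥ t.1 i) = 2 * (k.2.2 ⬝ᵥ t.1 i₀) + (t.1 i₀ ⬝ᵥ k.2.1) ^ 2 +
      (k.1 : ℂ) ^ 2 * (t.2 i₀ - t.1 i₀ ⬝ᵥ t.1 i₀) ∧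
    k.2.2 ⬝ᵥ k.2.2 = (k.1 : ℂ) ^ 2 * (2 * (k.2.2 ⬝ᵥ t.1 i₀) + (t.1 i₀ ⬝ᵥ k.2.1) ^ 2 +
      (k.1 : ℂ) ^ 2 * (t.2 i₀ - t.1 i₀ ⬝ᵥ t.1 i₀))

theorem isClosed_homogeneousTangency (i₀ : ι) :
    IsClosed {z : ((ι → Fin n → ℂ) × (ι → ℂ)) × (ℝ × (Fin n → ℂ) × (Fin n → ℂ)) |
      HomogeneousTangency i₀ z.1 z.2} := by
  simp only [HomogeneousTangency, dotProduct, Set.ofPred_and, Set.ofPred_forall]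
  refine .inter (isClosed_eq (by fun_prop) (by fun_prop)) (.inter
    (isClosed_eq (by fun_prop) (by fun_prop)) (isClosed_iInter fun i => .inter
    (isClosed_eq (by fun_prop) (by fun_prop)) (isClosed_eq (by fun_prop) (by fun_prop))))

/-- The weights are 1 for `v` and 2 for `p`. Since `p ⬝ p` would then dominate every sphere
equation, it is removed by differences with the equation of `i₀`, which is itself kept once. -/
theorem homogeneousTangency_iff (i₀ : ι) (t : (ι → Fin n → ℂ) × (ι → ℂ)) {s : ℝ} (hs : s ≠ 0)
    (v p : Fin n → ℂ) :
    HomogeneousTangency i₀ t (s, (s : ℂ) • v, (s : ℂ) ^ 2 • p) ↔ (v, p) ∈ tangentPairs t := by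
  have hs' : (s : ℂ) ≠ 0 := by exact_mod_cast hs
  simp only [HomogeneousTangency, mem_tangentPairs, dotProduct_smul, smul_dotProduct, smul_eq_mul]
  constructor
  · rintro ⟨h1, h2, h3⟩
    refine ⟨?_, ?_, fun i => ?_⟩
    · apply mul_left_cancel₀ (pow_ne_zero 2 hs')
      linear_combination h1
    · apply mul_left_cancel₀ (pow_ne_zero 3 hs')
      linear_combination h2
    · obtain ⟨h4, h5⟩ := h3 i
      apply mul_left_cancel₀ (pow_ne_zero 4 hs')
      linear_combination h5 - (s : ℂ) ^ 2 * h4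
  · rintro ⟨h1, h2, h3⟩
    refine ⟨?_, ?_, fun i => ⟨?_, ?_⟩⟩
    · linear_combination (s : ℂ) ^ 2 * h1
    · linear_combination (s : ℂ) ^ 3 * h2
    · linear_combination (s : ℂ) ^ 2 * (h3 i₀ - h3 i)
    · linear_combination (s : ℂ) ^ 4 * h3 i₀

/-- Near a configuration without tangents at infinity, tangents stay near the given ones. -/
theorem eventually_tangentPairs_subset [Nonempty ι] {t₀ : (ι → Fin n → ℂ) × (ι → ℂ)}
    (hinf : NoTangentsAtInfinity t₀.1) {W : Set ((Fin n → ℂ) × (Fin n → ℂ))} (hW : IsOpen W)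
    (h₀ : tangentPairs t₀ ⊆ W) : ∀ᶠ t in 𝓝 t₀, tangentPairs t ⊆ W := by
  obtain ⟨i₀⟩ := ‹Nonempty ι›
  -- A compact weighted unit sphere: every pair `(v, p)` rescales to a point of `K` with `s > 0`,
  -- and `s = 0` stands for infinity.
  let K : Set (ℝ × (Fin n → ℂ) × (Fin n → ℂ)) :=
    (Set.Icc 0 1 ×ˢ (Metric.closedBall 0 1 ×ˢ Metric.closedBall 0 1)) ∩
      ({k | k.1 = 1} ∪ ({k | ‖k.2.1‖ = 1} ∪ {k | ‖k.2.2‖ = 1}))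
  have hK : IsCompact K := by
    refine (isCompact_Icc.prod ((isCompact_closedBall _ _).prod
      (isCompact_closedBall _ _))).inter_right (.union ?_ (.union ?_ ?_)) <;>
    exact isClosed_eq (by fun_prop) (by fun_prop)
  have key : ∀ k ∈ K, ∀ᶠ z : ((ι → Fin n → ℂ) × (ι → ℂ)) × (ℝ × (Fin n → ℂ) × (Fin n → ℂ))
      in 𝓝 (t₀, k), HomogeneousTangency i₀ z.1 z.2 →
        ((z.2.1 : ℂ)⁻¹ • z.2.2.1, ((z.2.1 : ℂ) ^ 2)⁻¹ • z.2.2.2) ∈ W := by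
    rintro ⟨s, u, q⟩ hk
    by_cases hE : HomogeneousTangency i₀ t₀ (s, u, q)
    -- For `s = 0` the equations are exactly those excluded by `hinf`, and the origin is not in `K`.
    · have hs : s ≠ 0 := by
        rintro rfl
        obtain ⟨h1, h2, h3⟩ := hE
        have h := hinf u q _ (by simpa using h1) (by simpa using h2) (by simpa using (h3 i₀).2)
          (fun i => by simpa using (h3 i).1)
        simp [K, h.1, h.2] at hk
      have hs' : (s : ℂ) ≠ 0 := by exact_mod_cast hs
      have hmem : ((s : ℂ)⁻¹ • u, ((s : ℂ) ^ 2)⁻¹ • q) ∈ W := by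
        apply h₀
        rw [← homogeneousTangency_iff i₀ t₀ hs]
        simpa [smul_smul, hs'] using hE
      have hcont : ContinuousAt (fun z : ((ι → Fin n → ℂ) × (ι → ℂ)) ×
          (ℝ × (Fin n → ℂ) × (Fin n → ℂ)) =>
          ((z.2.1 : ℂ)⁻¹ • z.2.2.1, ((z.2.1 : ℂ) ^ 2)⁻¹ • z.2.2.2)) (t₀, s, u, q) := by
        have hc : ContinuousAt (fun z : ((ι → Fin n → ℂ) × (ι → ℂ)) ×
          (ℝ × (Fin n → ℂ) × (Fin n → ℂ)) => (z.2.1 : ℂ)) (t₀, s, u, q) := by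
          exact Continuous.continuousAt (by fun_prop)
        exact ((hc.inv₀ hs').smul (Continuous.continuousAt (by fun_prop))).prodMk
          (((hc.pow 2).inv₀ (pow_ne_zero 2 hs')).smul (Continuous.continuousAt (by fun_prop)))
      filter_upwards [hcont.preimage_mem_nhds (hW.mem_nhds hmem)] with z hz _
      exact hz
    · filter_upwards [(isClosed_homogeneousTangency i₀).isOpen_compl.mem_nhds
        (show (t₀, (s, u, q)) ∈ _ from hE)] with z hz hz'
      exact absurd hz' hz
  filter_upwards [hK.eventually_forall_of_forall_eventually
    (P := fun t k => HomogeneousTangency i₀ t k →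
      ((k.1 : ℂ)⁻¹ • k.2.1, ((k.1 : ℂ) ^ 2)⁻¹ • k.2.2) ∈ W) key] with t ht
  rintro ⟨v, p⟩ hx
  set m : ℝ := max 1 (max ‖v‖ (Real.sqrt ‖p‖)) with hm
  have hm1 : 1 ≤ m := le_max_left _ _
  have hm0 : 0 < m := by linarith
  have hmv : ‖v‖ ≤ m := (le_max_left _ _).trans (le_max_right _ _)
  have hmp : ‖p‖ ≤ m ^ 2 := by
    have : Real.sqrt ‖p‖ ≤ m := (le_max_right _ _).trans (le_max_right _ _)
    exact Real.sqrt_le_iff.mp this |>.2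
  have hs : m⁻¹ ≠ 0 := inv_ne_zero hm0.ne'
  have hs' : ((m⁻¹ : ℝ) : ℂ) ≠ 0 := by exact_mod_cast hs
  have hnv : ‖((m⁻¹ : ℝ) : ℂ) • v‖ = m⁻¹ * ‖v‖ := by
    rw [norm_smul, Complex.norm_real, Real.norm_of_nonneg (by positivity)]
  have hnp : ‖((m⁻¹ : ℝ) : ℂ) ^ 2 • p‖ = (m ^ 2)⁻¹ * ‖p‖ := by
    rw [norm_smul, norm_pow, Complex.norm_real, Real.norm_of_nonneg (by positivity), inv_pow]
  have hmem : (m⁻¹, ((m⁻¹ : ℝ) : ℂ) • v, ((m⁻¹ : ℝ) : ℂ) ^ 2 • p) ∈ K := by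
    refine ⟨⟨⟨by positivity, inv_le_one_of_one_le₀ hm1⟩, ?_, ?_⟩, ?_⟩
    · rw [mem_closedBall_zero_iff, hnv, inv_mul_le_iff₀ hm0]
      simpa using hmv
    · rw [mem_closedBall_zero_iff, hnp, inv_mul_le_iff₀ (by positivity)]
      simpa using hmp
    · rcases max_choice 1 (max ‖v‖ (Real.sqrt ‖p‖)) with h | h
      · left
        rw [← hm] at h
        simp [h]
      · right
        rcases max_choice ‖v‖ (Real.sqrt ‖p‖) with h' | h'
        · left
          rw [← hm, h'] at h
          change ‖_‖ = _
          rw [hnv, ← h]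
          exact inv_mul_cancel₀ hm0.ne'
        · right
          rw [← hm, h'] at h
          change ‖_‖ = _
          have : ‖p‖ = m ^ 2 := by rw [h, Real.sq_sqrt (norm_nonneg _)]
          rw [hnp, this]
          exact inv_mul_cancel₀ (by positivity)
  have := ht _ hmem ((homogeneousTangency_iff i₀ t hs v p).mpr hx)
  simpa [smul_smul, hs', hm0.ne'] using this

/-- The centers are not contained in a hyperplane. -/
def SpanningCenters (c : ι → Fin n → ℂ) : Prop :=
  ∀ v : Fin n → ℂ, (∀ i j, v ⬝ᵥ c i = v ⬝ᵥ c j) → v = 0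

/-- The condition is homogeneous in `v`, so it can be tested on the compact unit sphere, where it is
open in `(c, v)`. -/
theorem eventually_spanningCenters {c₀ : ι → Fin n → ℂ} (h : SpanningCenters c₀) :
    ∀ᶠ c in 𝓝 c₀, SpanningCenters c := by
  have key : ∀ v ∈ Metric.sphere (0 : Fin n → ℂ) 1, ∀ᶠ z : (ι → Fin n → ℂ) × (Fin n → ℂ)
      in 𝓝 (c₀, v), ∃ i j, z.2 ⬝ᵥ z.1 i ≠ z.2 ⬝ᵥ z.1 j := by
    intro v hv
    have : ∃ i j, v ⬝ᵥ c₀ i ≠ v ⬝ᵥ c₀ j := by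
      by_contra! hcon
      simp [h v hcon] at hv
    obtain ⟨i, j, hij⟩ := this
    have ho : IsOpen {z : (ι → Fin n → ℂ) × (Fin n → ℂ) | z.2 ⬝ᵥ z.1 i ≠ z.2 ⬝ᵥ z.1 j} := by
      simp only [dotProduct]
      exact isOpen_ne_fun (by fun_prop) (by fun_prop)
    filter_upwards [ho.mem_nhds (show (c₀, v) ∈ _ from hij)] with z hz
    exact ⟨i, j, hz⟩
  filter_upwards [(isCompact_sphere (0 : Fin n → ℂ) 1).eventually_forall_of_forall_eventually
    (P := fun c v => ∃ i j, v ⬝ᵥ c i ≠ v ⬝ᵥ c j) key] with c hc v hv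
  by_contra hv0
  have hn : ‖v‖ ≠ 0 := norm_ne_zero_iff.mpr hv0
  obtain ⟨i, j, hij⟩ := hc ((‖v‖⁻¹ : ℂ) • v) (by simp [norm_smul, hn])
  simp [smul_dotProduct, hv i j] at hij

end TangencyEquations

/-! ### Solving the equations of the special configuration -/

section SpecialConfiguration

variable {m : ℕ}

/-- The complexified special centers. -/
noncomputable def complexSpecialCenter (n : ℕ) (a : ℝ) : SpecialIndex n → Fin n → ℂ :=
  fun i => complexify (specialCenter n a i)

theorem dotProduct_eq_three_add (x y : Fin (m + 3) → ℂ) :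
    x ⬝ᵥ y = x 0 * y 0 + x 1 * y 1 + x 2 * y 2 +
      ∑ j : Fin m, x j.succ.succ.succ * y j.succ.succ.succ := by
  simp only [dotProduct, Fin.sum_univ_succ]
  simp only [← add_assoc]
  rfl

theorem complexSpecialCenter_inl_apply_lt (a : ℝ) (i : Fin 4) {k : Fin (m + 3)}
    (hk : (k : ℕ) < 3) :
    complexSpecialCenter (m + 3) a (Sum.inl i) k = tetrahedron i ⟨k, hk⟩ := by
  simp [complexSpecialCenter, complexify, specialCenter, hk]

theorem val_two_add_three : ((2 : Fin (m + 3)) : ℕ) = 2 := by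
  have h : 2 < m + 3 := by omega
  exact Nat.mod_eq_of_lt h

theorem complexSpecialCenter_inl_zero (a : ℝ) (i : Fin 4) :
    complexSpecialCenter (m + 3) a (Sum.inl i) 0 = tetrahedron i 0 :=
  complexSpecialCenter_inl_apply_lt a i (by simp)

theorem complexSpecialCenter_inl_one (a : ℝ) (i : Fin 4) :
    complexSpecialCenter (m + 3) a (Sum.inl i) 1 = tetrahedron i 1 := by
  rw [complexSpecialCenter_inl_apply_lt a i (by simp)]
  simp

theorem complexSpecialCenter_inl_two (a : ℝ) (i : Fin 4) :
    complexSpecialCenter (m + 3) a (Sum.inl i) 2 = tetrahedron i 2 := by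
  rw [complexSpecialCenter_inl_apply_lt a i (by rw [val_two_add_three]; norm_num)]
  simp only [val_two_add_three]
  rfl

theorem complexSpecialCenter_inl_tail (a : ℝ) (i : Fin 4) (j : Fin m) :
    complexSpecialCenter (m + 3) a (Sum.inl i) j.succ.succ.succ = 0 := by
  simp [complexSpecialCenter, complexify, specialCenter]

theorem dotProduct_complexSpecialCenter_inl (a : ℝ) (x : Fin (m + 3) → ℂ) (i : Fin 4) :
    x ⬝ᵥ complexSpecialCenter (m + 3) a (Sum.inl i) =
      x 0 * tetrahedron i 0 + x 1 * tetrahedron i 1 + x 2 * tetrahedron i 2 := by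
  simp [dotProduct_eq_three_add, complexSpecialCenter_inl_zero, complexSpecialCenter_inl_one,
    complexSpecialCenter_inl_two, complexSpecialCenter_inl_tail]

/-- The `j`-th of the coordinates after the first three. -/
def tailIndex (j : Fin m) : {j : Fin (m + 3) // 3 ≤ (j : ℕ)} :=
  ⟨j.succ.succ.succ, by simp⟩

theorem exists_eq_tailIndex (k : {j : Fin (m + 3) // 3 ≤ (j : ℕ)}) : ∃ j, k = tailIndex j := by
  obtain ⟨⟨k, hk⟩, h⟩ := k
  simp only at h
  exact ⟨⟨k - 3, by omega⟩, by simp [tailIndex]; omega⟩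

theorem dotProduct_complexSpecialCenter_inr (a : ℝ) (x : Fin (m + 3) → ℂ) (j : Fin m) (b : Bool) :
    x ⬝ᵥ complexSpecialCenter (m + 3) a (Sum.inr (tailIndex j, b)) =
      x j.succ.succ.succ * (if b then (a : ℂ) else -(a : ℂ)) := by
  have h : complexSpecialCenter (m + 3) a (Sum.inr (tailIndex j, b)) =
      Pi.single j.succ.succ.succ (if b then (a : ℂ) else -(a : ℂ)) := by
    ext k
    cases b <;>
    · by_cases hk : k = j.succ.succ.succ
      · subst hk
        simp [complexSpecialCenter, complexify, specialCenter, tailIndex]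
      · simp [complexSpecialCenter, complexify, specialCenter, tailIndex, hk]
  rw [h, dotProduct_single]

theorem complexSpecialCenter_inl_dotProduct_self (a : ℝ) (i : Fin 4) :
    complexSpecialCenter (m + 3) a (Sum.inl i) ⬝ᵥ complexSpecialCenter (m + 3) a (Sum.inl i) =
      3 := by
  rw [dotProduct_complexSpecialCenter_inl, complexSpecialCenter_inl_zero,
    complexSpecialCenter_inl_one, complexSpecialCenter_inl_two]
  fin_cases i <;> simp [tetrahedron] <;> norm_num

theorem complexSpecialCenter_inr_dotProduct_self (a : ℝ) (j : Fin m) (b : Bool) :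
    complexSpecialCenter (m + 3) a (Sum.inr (tailIndex j, b)) ⬝ᵥ
      complexSpecialCenter (m + 3) a (Sum.inr (tailIndex j, b)) = (a : ℂ) ^ 2 := by
  rw [dotProduct_complexSpecialCenter_inr]
  cases b <;> simp [complexSpecialCenter, complexify, specialCenter, tailIndex] <;> ring

/-- The solution of the inhomogeneous linear system for `q` given by the special centers. -/
theorem specialCenter_system_iff {a : ℝ} (ha : a ≠ 0) (q u w : Fin (m + 3) → ℂ) (κ e : ℂ) :
    (∀ i, 2 * (q ⬝ᵥ complexSpecialCenter (m + 3) a i) +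
      (u ⬝ᵥ complexSpecialCenter (m + 3) a i) * (w ⬝ᵥ complexSpecialCenter (m + 3) a i) +
      κ * (complexSpecialCenter (m + 3) a i ⬝ᵥ complexSpecialCenter (m + 3) a i) = e) ↔
    ((2 * q 0 = -(u 1 * w 2 + u 2 * w 1) ∧ 2 * q 1 = -(u 0 * w 2 + u 2 * w 0) ∧
      2 * q 2 = -(u 0 * w 1 + u 1 * w 0) ∧
      u 0 * w 0 + u 1 * w 1 + u 2 * w 2 + 3 * κ = e) ∧
      ∀ j : Fin m, q j.succ.succ.succ = 0 ∧
        (a : ℂ) ^ 2 * (u j.succ.succ.succ * w j.succ.succ.succ + κ) = e) := by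
  have ha' : (a : ℂ) ≠ 0 := by exact_mod_cast ha
  rw [Sum.forall]
  refine and_congr ?_ ?_
  · simp only [dotProduct_complexSpecialCenter_inl _ q, dotProduct_complexSpecialCenter_inl _ u,
      dotProduct_complexSpecialCenter_inl _ w, complexSpecialCenter_inl_dotProduct_self]
    constructor
    · intro h
      have h0 := h 0
      have h1 := h 1
      have h2 := h 2
      have h3 := h 3
      simp [tetrahedron] at h0 h1 h2 h3
      refine ⟨?_, ?_, ?_, ?_⟩
      -- The signs are the coordinate columns of the tetrahedron. Together with the all-ones column
      -- they form a Hadamard matrix of order 4, and the product of two coordinate columns is the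
      -- third.
      · linear_combination (h0 + h1 - h2 - h3) / 4
      · linear_combination (h0 - h1 + h2 - h3) / 4
      · linear_combination (h0 - h1 - h2 + h3) / 4
      · linear_combination (h0 + h1 + h2 + h3) / 4
    · rintro ⟨h0, h1, h2, h3⟩ i
      fin_cases i <;> simp [tetrahedron]
      · linear_combination h0 + h1 + h2 + h3
      · linear_combination h0 - h1 - h2 + h3
      · linear_combination -h0 + h1 - h2 + h3
      · linear_combination -h0 - h1 + h2 + h3
  · constructor
    · intro h j
      have h0 := h (tailIndex j, true)
      have h1 := h (tailIndex j, false)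
      simp only [dotProduct_complexSpecialCenter_inr _ q, dotProduct_complexSpecialCenter_inr _ u,
        dotProduct_complexSpecialCenter_inr _ w, complexSpecialCenter_inr_dotProduct_self] at h0 h1
      simp at h0 h1
      constructor
      · apply mul_left_cancel₀ ha'
        linear_combination (h0 - h1) / 4
      · linear_combination (h0 + h1) / 2
    · rintro h ⟨k, b⟩
      obtain ⟨j, rfl⟩ := exists_eq_tailIndex k
      obtain ⟨h0, h1⟩ := h j
      simp only [dotProduct_complexSpecialCenter_inr _ q, dotProduct_complexSpecialCenter_inr _ u,
        dotProduct_complexSpecialCenter_inr _ w, complexSpecialCenter_inr_dotProduct_self]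
      cases b <;> simp [h0] <;> linear_combination h1

/-- The foot point determined by the direction of a tangent. -/
def foot (v : Fin (m + 3) → ℂ) : Fin (m + 3) → ℂ :=
  Fin.cons (-(v 1 * v 2)) (Fin.cons (-(v 0 * v 2)) (Fin.cons (-(v 0 * v 1)) fun _ => 0))

theorem foot_zero (v : Fin (m + 3) → ℂ) : foot v 0 = -(v 1 * v 2) := rfl
theorem foot_one (v : Fin (m + 3) → ℂ) : foot v 1 = -(v 0 * v 2) := rfl
theorem foot_two (v : Fin (m + 3) → ℂ) : foot v 2 = -(v 0 * v 1) := rfl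
theorem foot_succ (v : Fin (m + 3) → ℂ) (j : Fin m) : foot v j.succ.succ.succ = 0 := rfl

theorem ext_three {x y : Fin (m + 3) → ℂ} (h0 : x 0 = y 0) (h1 : x 1 = y 1) (h2 : x 2 = y 2)
    (h : ∀ j : Fin m, x j.succ.succ.succ = y j.succ.succ.succ) : x = y := by
  ext k
  refine Fin.cases h0 (fun k => Fin.cases h1 (fun k => Fin.cases h2 (fun k => h k) k) k) k

/-- The directions of the common tangents of the special configuration. -/
def directions (m : ℕ) (s μ ω : ℂ) : Set (Fin (m + 3) → ℂ) :=
  {v | v 0 * v 1 * v 2 = 0 ∧ v 0 ^ 2 + v 1 ^ 2 + v 2 ^ 2 = s ∧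
    (v 1 * v 2) ^ 2 + (v 0 * v 2) ^ 2 + (v 0 * v 1) ^ 2 = μ ∧
    ∀ j : Fin m, v j.succ.succ.succ ^ 2 = ω}

/-- The common value of `v j ^ 2` for the last coordinates of the directions of tangents. -/
noncomputable def tailSquare (m : ℕ) (a : ℝ) : ℝ := (a ^ 2 - 2) / (a ^ 2 + m)

theorem gam_add_three (m : ℕ) (a : ℝ) : gam (m + 3) a = a ^ 2 * (m + 2) / (a ^ 2 + m) := by
  simp only [gam]
  push_cast
  ring_nf

/-- The data of the special configuration, in the form used for the tangency equations. -/
noncomputable def specialData (n : ℕ) (a r : ℝ) :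
    (SpecialIndex n → Fin n → ℂ) × (SpecialIndex n → ℂ) :=
  (complexSpecialCenter n a, fun _ => (r : ℂ) ^ 2)

/-- The sphere equations are linear in `p` once `e = p ⬝ p - r ^ 2` is treated as a constant. They
give `p = foot v` and express the squares of the tail coordinates through the sum of the first three
squares; `v ⬝ v = 1` then yields `e = -γ`. Finally `p ⬝ v` is `-3 * v 0 * v 1 * v 2`, and `p ⬝ p` is
the second symmetric function of the first three squares. -/
theorem mem_tangentPairs_specialData {a : ℝ} (ha : a ≠ 0) (r : ℝ)
    (x : (Fin (m + 3) → ℂ) × (Fin (m + 3) → ℂ)) :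
    x ∈ tangentPairs (specialData (m + 3) a r) ↔
      x.1 ∈ directions m (3 - gam (m + 3) a : ℝ) (r ^ 2 - gam (m + 3) a : ℝ) (tailSquare m a : ℝ) ∧
        x.2 = foot x.1 := by
  obtain ⟨v, p⟩ := x
  have hpos : (0 : ℝ) < a ^ 2 + m := by positivity
  have hden : ((a : ℂ) ^ 2 + m) ≠ 0 := by exact_mod_cast hpos.ne'
  have ha' : (a : ℂ) ^ 2 ≠ 0 := by exact_mod_cast pow_ne_zero 2 ha
  have hg : ((gam (m + 3) a : ℝ) : ℂ) * ((a : ℂ) ^ 2 + m) = (a : ℂ) ^ 2 * (m + 2) := by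
    rw [gam_add_three]
    push_cast
    field_simp
  have hω : ((tailSquare m a : ℝ) : ℂ) * ((a : ℂ) ^ 2 + m) = (a : ℂ) ^ 2 - 2 := by
    rw [tailSquare]
    push_cast
    field_simp
  have hga : (a : ℂ) ^ 2 * (tailSquare m a : ℝ) = (a : ℂ) ^ 2 - (gam (m + 3) a : ℝ) := by
    apply mul_left_cancel₀ hden
    linear_combination (a : ℂ) ^ 2 * hω + hg
  generalize hG : ((gam (m + 3) a : ℝ) : ℂ) = G at *
  generalize hΩ : ((tailSquare m a : ℝ) : ℂ) = Ω at *
  have hsys : (∀ i, p ⬝ᵥ p - 2 * (p ⬝ᵥ complexSpecialCenter (m + 3) a i) +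
      complexSpecialCenter (m + 3) a i ⬝ᵥ complexSpecialCenter (m + 3) a i -
      (complexSpecialCenter (m + 3) a i ⬝ᵥ v) ^ 2 = (r : ℂ) ^ 2) ↔ _ :=
    Iff.trans (forall_congr' fun i => by
      rw [dotProduct_comm _ v]
      constructor
      · intro h
        linear_combination -h
      · intro h
        linear_combination -h)
      (specialCenter_system_iff ha p v v (-1) (p ⬝ᵥ p - (r : ℂ) ^ 2))
  rw [mem_tangentPairs]
  simp only [specialData]
  rw [hsys]
  simp only [directions, Set.mem_ofPred_eq, Complex.ofReal_ofNat, Complex.ofReal_sub, Complex.ofReal_pow, hG]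
  simp only [dotProduct_eq_three_add]
  constructor
  · rintro ⟨hv, hpv, ⟨h0, h1, h2, h3⟩, h4⟩
    have hp : p = foot v := by
      refine ext_three ?_ ?_ ?_ fun j => (h4 j).1
      · rw [foot_zero]; linear_combination h0 / 2
      · rw [foot_one]; linear_combination h1 / 2
      · rw [foot_two]; linear_combination h2 / 2
    subst hp
    simp only [foot_zero, foot_one, foot_two, foot_succ] at *
    simp only [zero_mul, Finset.sum_const_zero] at *
    have hj : ∀ j : Fin m, (a : ℂ) ^ 2 * (v j.succ.succ.succ * v j.succ.succ.succ) =
        (a : ℂ) ^ 2 + (v 0 * v 0 + v 1 * v 1 + v 2 * v 2 - 3) := by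
      intro j
      linear_combination (h4 j).2 - h3
    have hsum : (a : ℂ) ^ 2 * ∑ j : Fin m, v j.succ.succ.succ * v j.succ.succ.succ =
        m * ((a : ℂ) ^ 2 + (v 0 * v 0 + v 1 * v 1 + v 2 * v 2 - 3)) := by
      rw [Finset.mul_sum, Finset.sum_congr rfl fun j _ => hj j]
      simp only [Finset.sum_const, Finset.card_univ, Fintype.card_fin, nsmul_eq_mul]
    have hs : v 0 ^ 2 + v 1 ^ 2 + v 2 ^ 2 = 3 - G := by
      apply mul_left_cancel₀ hden
      linear_combination (a : ℂ) ^ 2 * hv - hsum + hg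
    refine ⟨⟨?_, hs, ?_, fun j => ?_⟩, trivial⟩
    · linear_combination -hpv / 3
    · linear_combination hs - h3
    · apply mul_left_cancel₀ ha'
      linear_combination hj j + hs - hga
  · rintro ⟨⟨h0, hs, hμ, hj⟩, rfl⟩
    simp only [foot_zero, foot_one, foot_two, foot_succ]
    simp only [zero_mul, Finset.sum_const_zero]
    have hsum : ∑ j : Fin m, v j.succ.succ.succ * v j.succ.succ.succ = m * Ω := by
      rw [Finset.sum_congr rfl fun j _ => (pow_two _).symm.trans (hj j)]
      simp
    refine ⟨?_, ?_, ⟨by ring, by ring, by ring, ?_⟩, fun j => ⟨trivial, ?_⟩⟩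
    · rw [hsum]
      apply mul_left_cancel₀ hden
      linear_combination ((a : ℂ) ^ 2 + m) * hs - hg + m * hω
    · linear_combination -3 * h0
    · linear_combination hs - hμ
    · linear_combination (a : ℂ) ^ 2 * hj j - hμ + hga

theorem spanningCenters_complexSpecialCenter {a : ℝ} (ha : a ≠ 0) :
    SpanningCenters (complexSpecialCenter (m + 3) a) := by
  intro v hv
  have h := (specialCenter_system_iff ha v 0 0 0
    (2 * (v ⬝ᵥ complexSpecialCenter (m + 3) a (Sum.inl 0)))).mp (fun i => by simp [hv i (Sum.inl 0)])
  obtain ⟨⟨h0, h1, h2, -⟩, h3⟩ := h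
  exact ext_three (by simpa using h0) (by simpa using h1) (by simpa using h2) fun j => (h3 j).1

theorem noTangentsAtInfinity_complexSpecialCenter {a : ℝ} (ha : a ≠ 0) :
    NoTangentsAtInfinity (complexSpecialCenter (m + 3) a) := by
  intro u q e huu hqu hqq h
  have ha' : (a : ℂ) ^ 2 ≠ 0 := by exact_mod_cast pow_ne_zero 2 ha
  have hpos : (0 : ℝ) < a ^ 2 + m := by positivity
  have hden : ((a : ℂ) ^ 2 + m) ≠ 0 := by exact_mod_cast hpos.ne'
  obtain ⟨⟨h0, h1, h2, h3⟩, h4⟩ := (specialCenter_system_iff ha q u u 0 e).mp (fun i => by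
    rw [← h i, dotProduct_comm _ u]
    ring)
  have hq : q = foot u := by
    refine ext_three ?_ ?_ ?_ fun j => (h4 j).1
    · rw [foot_zero]; linear_combination h0 / 2
    · rw [foot_one]; linear_combination h1 / 2
    · rw [foot_two]; linear_combination h2 / 2
  subst hq
  simp only [dotProduct_eq_three_add, foot_zero, foot_one, foot_two, foot_succ, zero_mul,
    Finset.sum_const_zero] at *
  have hsum : (a : ℂ) ^ 2 * ∑ j : Fin m, u j.succ.succ.succ * u j.succ.succ.succ = m * e := by
    rw [Finset.mul_sum, Finset.sum_congr rfl fun j _ =>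
      show (a : ℂ) ^ 2 * (u j.succ.succ.succ * u j.succ.succ.succ) = e by
        linear_combination (h4 j).2]
    simp
  have he : e = 0 := by
    apply mul_left_cancel₀ hden
    linear_combination (a : ℂ) ^ 2 * huu - hsum - (a : ℂ) ^ 2 * h3
  subst he
  have hprod : u 0 * u 1 * u 2 = 0 := by linear_combination -hqu / 3
  -- All elementary symmetric functions of the first three squares vanish, so each square is a root
  -- of `T ^ 3`.
  have hcube : ∀ k : Fin (m + 3), k = 0 ∨ k = 1 ∨ k = 2 → u k = 0 := by
    intro k hk
    have : u k ^ 6 = 0 := by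
      rcases hk with rfl | rfl | rfl
      · linear_combination u 0 ^ 4 * h3 - u 0 ^ 2 * hqq + u 0 * u 1 * u 2 * hprod
      · linear_combination u 1 ^ 4 * h3 - u 1 ^ 2 * hqq + u 0 * u 1 * u 2 * hprod
      · linear_combination u 2 ^ 4 * h3 - u 2 ^ 2 * hqq + u 0 * u 1 * u 2 * hprod
    exact pow_eq_zero_iff (by norm_num) |>.mp this
  have hu0 := hcube 0 (Or.inl rfl)
  have hu1 := hcube 1 (Or.inr (Or.inl rfl))
  have hu2 := hcube 2 (Or.inr (Or.inr rfl))
  constructor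
  · refine ext_three hu0 hu1 hu2 fun j => ?_
    simpa [ha'] using (h4 j).2
  · exact ext_three (by simp [foot_zero, hu1]) (by simp [foot_one, hu0]) (by simp [foot_two, hu0])
      fun j => rfl

/-- Conditions under which the special configuration has nondegenerate common tangents. -/
def Nondegenerate (m : ℕ) (a r : ℝ) : Prop :=
  a ≠ 0 ∧ r ^ 2 - gam (m + 3) a ≠ 0 ∧ (3 - gam (m + 3) a) ^ 2 ≠ 4 * (r ^ 2 - gam (m + 3) a) ∧
    (m ≠ 0 → tailSquare m a ≠ 0)

/-- The nondegeneracy of tangents in three variables, where `y` and `z` are the nonzero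
coordinates of the direction. -/
theorem three_dim_nondegenerate {y z dx dy dz : ℂ} (hyz : y * z ≠ 0) (hne : y ^ 2 ≠ z ^ 2)
    (h1 : y * z * dx = 0) (h2 : y * z * (y * dz + z * dy) = 0) (h3 : y * dy + z * dz = 0) :
    dx = 0 ∧ dy = 0 ∧ dz = 0 := by
  have hdx := (mul_eq_zero.mp h1).resolve_left hyz
  have h4 := (mul_eq_zero.mp h2).resolve_left hyz
  have hne' : y ^ 2 - z ^ 2 ≠ 0 := sub_ne_zero.mpr hne
  refine ⟨hdx, ?_, ?_⟩
  · apply (mul_eq_zero.mp (show (y ^ 2 - z ^ 2) * dy = 0 by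
      linear_combination y * h3 - z * h4)).resolve_left hne'
  · apply (mul_eq_zero.mp (show (y ^ 2 - z ^ 2) * dz = 0 by
      linear_combination y * h4 - z * h3)).resolve_left hne'

/-- The polarized linear system expresses `q` through `w`, and with `v ⬝ w = 0` it makes the
linearized sum of the first three squares, `E`, vanish. What remains for `w 0`, `w 1`, `w 2` is the
linearization of the three symmetric equations. It is injective because exactly one of the first
three coordinates of `v` is zero and the other two have distinct squares: `s ^ 2 - 4 * μ` is the
square of their difference. -/
theorem fderiv_specialData_ker {a r : ℝ} (h : Nondegenerate m a r)
    {x : (Fin (m + 3) → ℂ) × (Fin (m + 3) → ℂ)}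
    (hx : x ∈ tangentPairs (specialData (m + 3) a r))
    (y : (Fin (m + 3) → ℂ) × (Fin (m + 3) → ℂ))
    (hy : fderiv ℂ tangencyMap (specialData (m + 3) a r, x) (0, y) = 0) : y = 0 := by
  obtain ⟨ha, hμ, hdisc, hω⟩ := h
  obtain ⟨v, p⟩ := x
  obtain ⟨⟨hprod, hs, hpair, hj⟩, hp⟩ := (mem_tangentPairs_specialData ha r _).mp hx
  obtain ⟨w, q⟩ := y
  simp only at hprod hs hpair hj hp
  subst hp
  have hμ' : ((r ^ 2 - gam (m + 3) a : ℝ) : ℂ) ≠ 0 := by exact_mod_cast hμ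
  have hdisc' : ((3 - gam (m + 3) a : ℝ) : ℂ) ^ 2 ≠ 4 * ((r ^ 2 - gam (m + 3) a : ℝ) : ℂ) := by
    exact_mod_cast hdisc
  have hω' : m ≠ 0 → ((tailSquare m a : ℝ) : ℂ) ≠ 0 := fun h => by exact_mod_cast hω h
  generalize ((r ^ 2 - gam (m + 3) a : ℝ) : ℂ) = μ at *
  generalize ((3 - gam (m + 3) a : ℝ) : ℂ) = s at *
  generalize ((tailSquare m a : ℝ) : ℂ) = Ω at *
  have ha' : (a : ℂ) ^ 2 ≠ 0 := by exact_mod_cast pow_ne_zero 2 ha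
  have hpos : (0 : ℝ) < a ^ 2 + m := by positivity
  have hden : ((a : ℂ) ^ 2 + m) ≠ 0 := by exact_mod_cast hpos.ne'
  rw [fderiv_tangencyMap_apply] at hy
  simp only [Prod.mk_eq_zero, funext_iff, Pi.zero_apply] at hy
  obtain ⟨hvw, hpw, hc⟩ := hy
  obtain ⟨⟨h0, h1, h2, h3⟩, h4⟩ := (specialCenter_system_iff ha q v (2 • w) 0
    (2 * (foot v ⬝ᵥ q))).mp (fun i => by
      have := hc i
      simp only [specialData] at this
      rw [dotProduct_comm _ v, dotProduct_comm _ w] at this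
      simp only [two_smul, add_dotProduct]
      linear_combination -this)
  simp only [Pi.smul_apply, nsmul_eq_mul, Nat.cast_ofNat] at h0 h1 h2 h3 h4
  simp only [dotProduct_eq_three_add, foot_zero, foot_one, foot_two, foot_succ, zero_mul,
    Finset.sum_const_zero] at *
  have hq : ∀ j : Fin m, q j.succ.succ.succ = 0 := fun j => (h4 j).1
  simp only [hq, zero_mul, Finset.sum_const_zero] at hpw
  set E : ℂ := v 0 * w 0 + v 1 * w 1 + v 2 * w 2 with hE
  have hjE : ∀ j : Fin m, (a : ℂ) ^ 2 * (v j.succ.succ.succ * w j.succ.succ.succ) = E := by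
    intro j
    linear_combination (h4 j).2 / 2 - h3 / 2
  have hsum : (a : ℂ) ^ 2 * ∑ j : Fin m, v j.succ.succ.succ * w j.succ.succ.succ = m * E := by
    rw [Finset.mul_sum, Finset.sum_congr rfl fun j _ => hjE j]
    simp
  have hE0 : E = 0 := by
    apply mul_left_cancel₀ hden
    linear_combination (a : ℂ) ^ 2 * hvw / 2 - hsum
  have hq0 : q 0 = -(v 1 * w 2 + v 2 * w 1) := by linear_combination h0 / 2
  have hq1 : q 1 = -(v 0 * w 2 + v 2 * w 0) := by linear_combination h1 / 2
  have hq2 : q 2 = -(v 0 * w 1 + v 1 * w 0) := by linear_combination h2 / 2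
  rw [hq0, hq1, hq2] at h3 hpw
  have hw3 : w 0 = 0 ∧ w 1 = 0 ∧ w 2 = 0 := by
    rcases mul_eq_zero.mp hprod with hprod | hz
    · rcases mul_eq_zero.mp hprod with hz | hz
      · rw [hz] at hs hpair h3 hpw hE
        have hyz : v 1 * v 2 ≠ 0 := by
          intro h
          exact hμ' (by rw [← hpair, h]; ring)
        refine three_dim_nondegenerate hyz (fun h => hdisc' ?_) ?_ ?_ ?_
        · rw [← hs, ← hpair]
          linear_combination (v 1 ^ 2 - v 2 ^ 2) * h
        · linear_combination -hpw / 3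
        · linear_combination -h3 / 2 + hE0 - hE
        · linear_combination hE0 - hE
      · rw [hz] at hs hpair h3 hpw hE
        have hyz : v 0 * v 2 ≠ 0 := by
          intro h
          exact hμ' (by rw [← hpair, h]; ring)
        have := three_dim_nondegenerate (dx := w 1) (dy := w 0) (dz := w 2) hyz
          (fun h => hdisc' ?_) ?_ ?_ ?_
        · exact ⟨this.2.1, this.1, this.2.2⟩
        · rw [← hs, ← hpair]
          linear_combination (v 0 ^ 2 - v 2 ^ 2) * h
        · linear_combination -hpw / 3
        · linear_combination -h3 / 2 + hE0 - hE
        · linear_combination hE0 - hE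
    · rw [hz] at hs hpair h3 hpw hE
      have hyz : v 0 * v 1 ≠ 0 := by
        intro h
        exact hμ' (by rw [← hpair, h]; ring)
      have := three_dim_nondegenerate (dx := w 2) (dy := w 0) (dz := w 1) hyz
        (fun h => hdisc' ?_) ?_ ?_ ?_
      · exact ⟨this.2.1, this.2.2, this.1⟩
      · rw [← hs, ← hpair]
        linear_combination (v 0 ^ 2 - v 1 ^ 2) * h
      · linear_combination -hpw / 3
      · linear_combination -h3 / 2 + hE0 - hE
      · linear_combination hE0 - hE
  obtain ⟨hw0, hw1, hw2⟩ := hw3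
  have hw : w = 0 := by
    refine ext_three hw0 hw1 hw2 fun j => ?_
    have hvj : v j.succ.succ.succ ≠ 0 := by
      intro h
      have := hj j
      rw [h] at this
      exact hω' (by have := j.2; omega) (by rw [← this]; ring)
    have h5 := hjE j
    rw [hE0] at h5
    simpa [ha', hvj] using h5
  have hqz : q = 0 := ext_three (by simp [hq0, hw1, hw2]) (by simp [hq1, hw0, hw2])
    (by simp [hq2, hw0, hw1]) hq
  rw [hw, hqz]
  rfl

end SpecialConfiguration

/-! ### Counting directions -/

section Counting

theorem setOf_sq_eq (z : ℂ) : {y : ℂ | y ^ 2 = z ^ 2} = {z, -z} := by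
  ext y
  simp [sq_eq_sq_iff_eq_or_eq_neg]

theorem encard_sq_eq {ω : ℂ} (hω : ω ≠ 0) : {y : ℂ | y ^ 2 = ω}.encard = 2 := by
  obtain ⟨z, rfl⟩ := IsSquare.exists_sq ω (IsAlgClosed.exists_eq_mul_self ω)
  have hz : z ≠ 0 := by
    rintro rfl
    simp at hω
  rw [setOf_sq_eq, Set.encard_pair (self_ne_neg.mpr hz)]

theorem encard_forall_sq_eq {m : ℕ} {ω : ℂ} (hω : m ≠ 0 → ω ≠ 0) :
    {y : Fin m → ℂ | ∀ j, y j ^ 2 = ω}.encard = 2 ^ m := by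
  rcases Nat.eq_zero_or_pos m with rfl | hm
  · have : {y : Fin 0 → ℂ | ∀ j, y j ^ 2 = ω} = {0} := by
      ext y
      simp [Subsingleton.elim y 0]
    rw [this]
    simp
  · obtain ⟨z, rfl⟩ := IsSquare.exists_sq ω (IsAlgClosed.exists_eq_mul_self ω)
    have hz : z ≠ 0 := by
      rintro rfl
      simpa using hω hm.ne'
    have : {y : Fin m → ℂ | ∀ j, y j ^ 2 = z ^ 2} =
        ↑(Fintype.piFinset fun _ : Fin m => ({z, -z} : Finset ℂ)) := by
      ext y
      simp [sq_eq_sq_iff_eq_or_eq_neg]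
    rw [this, Set.encard_coe_eq_coe_finsetCard, Fintype.card_piFinset]
    simp [Finset.card_pair (self_ne_neg.mpr hz)]

/-- The two squares are the distinct nonzero roots `A`, `B` of `T ^ 2 - s T + μ` in either order,
and each has two square roots. -/
theorem encard_pairs {s μ : ℂ} (hμ : μ ≠ 0) (hd : s ^ 2 ≠ 4 * μ) :
    {q : ℂ × ℂ | q.1 ^ 2 + q.2 ^ 2 = s ∧ (q.1 * q.2) ^ 2 = μ}.encard = 8 := by
  obtain ⟨d, hd'⟩ := IsSquare.exists_sq (s ^ 2 - 4 * μ) (IsAlgClosed.exists_eq_mul_self _)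
  have hd0 : d ≠ 0 := by
    rintro rfl
    exact hd (by linear_combination hd')
  obtain ⟨A, hA⟩ : ∃ A, A = (s + d) / 2 := ⟨_, rfl⟩
  obtain ⟨B, hB⟩ : ∃ B, B = (s - d) / 2 := ⟨_, rfl⟩
  have hs : s = A + B := by rw [hA, hB]; ring
  have hAB : μ = A * B := by rw [hA, hB]; linear_combination -hd' / 4
  have hne : A ≠ B := by
    intro h
    exact hd0 (by linear_combination h - hA + hB)
  have hA0 : A ≠ 0 := by rintro rfl; simp [hAB] at hμ
  have hB0 : B ≠ 0 := by rintro rfl; simp [hAB] at hμ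
  have h : {q : ℂ × ℂ | q.1 ^ 2 + q.2 ^ 2 = s ∧ (q.1 * q.2) ^ 2 = μ} =
      ({y : ℂ | y ^ 2 = A} ×ˢ {y : ℂ | y ^ 2 = B}) ∪
        ({y : ℂ | y ^ 2 = B} ×ˢ {y : ℂ | y ^ 2 = A}) := by
    ext ⟨y, z⟩
    simp only [Set.mem_ofPred_eq, Set.mem_union, Set.mem_prod]
    constructor
    · rintro ⟨h1, h2⟩
      have h3 : (y ^ 2 - A) * (y ^ 2 - B) = 0 := by
        linear_combination y ^ 2 * h1 - h2 + y ^ 2 * hs - hAB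
      rcases mul_eq_zero.mp h3 with h4 | h4
      · exact Or.inl ⟨by linear_combination h4, by linear_combination h1 - h4 + hs⟩
      · exact Or.inr ⟨by linear_combination h4, by linear_combination h1 - h4 + hs⟩
    · rintro (⟨h1, h2⟩ | ⟨h1, h2⟩) <;>
      exact ⟨by linear_combination h1 + h2 - hs, by rw [mul_pow, h1, h2, hAB] <;> ring⟩
  rw [h, Set.encard_union_eq, Set.encard_prod, Set.encard_prod, encard_sq_eq hA0, encard_sq_eq hB0]
  · norm_num
  · rw [Set.disjoint_left]
    rintro ⟨y, z⟩ ⟨h1, -⟩ ⟨h2, -⟩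
    exact hne (h1.symm.trans h2)

/-- Since `μ ≠ 0`, exactly one coordinate vanishes, and its position splits the set into three
disjoint copies of the pairs. -/
theorem encard_triples {s μ : ℂ} (hμ : μ ≠ 0) (hd : s ^ 2 ≠ 4 * μ) :
    {q : ℂ × ℂ × ℂ | q.1 * q.2.1 * q.2.2 = 0 ∧ q.1 ^ 2 + q.2.1 ^ 2 + q.2.2 ^ 2 = s ∧
      (q.2.1 * q.2.2) ^ 2 + (q.1 * q.2.2) ^ 2 + (q.1 * q.2.1) ^ 2 = μ}.encard = 24 := by
  set S := {q : ℂ × ℂ | q.1 ^ 2 + q.2 ^ 2 = s ∧ (q.1 * q.2) ^ 2 = μ} with hS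
  have hne : ∀ q ∈ S, q.1 ≠ 0 ∧ q.2 ≠ 0 := by
    rintro q ⟨-, hq⟩
    rw [← hq] at hμ
    exact mul_ne_zero_iff.mp (fun h => hμ (by rw [h]; norm_num))
  have h : {q : ℂ × ℂ × ℂ | q.1 * q.2.1 * q.2.2 = 0 ∧ q.1 ^ 2 + q.2.1 ^ 2 + q.2.2 ^ 2 = s ∧
      (q.2.1 * q.2.2) ^ 2 + (q.1 * q.2.2) ^ 2 + (q.1 * q.2.1) ^ 2 = μ} =
      ((fun q : ℂ × ℂ => ((0 : ℂ), q.1, q.2)) '' S ∪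
        (fun q : ℂ × ℂ => (q.1, (0 : ℂ), q.2)) '' S) ∪
        (fun q : ℂ × ℂ => (q.1, q.2, (0 : ℂ))) '' S := by
    ext ⟨x, y, z⟩
    simp only [hS, Set.mem_ofPred_eq, Set.mem_union, Set.mem_image, Prod.mk.injEq, Prod.exists]
    constructor
    · rintro ⟨h0, h1, h2⟩
      rcases mul_eq_zero.mp h0 with h0 | rfl
      · rcases mul_eq_zero.mp h0 with rfl | rfl
        · exact Or.inl (Or.inl ⟨y, z, ⟨by linear_combination h1, by linear_combination h2⟩,
            rfl, rfl, rfl⟩)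
        · exact Or.inl (Or.inr ⟨x, z, ⟨by linear_combination h1, by linear_combination h2⟩,
            rfl, rfl, rfl⟩)
      · exact Or.inr ⟨x, y, ⟨by linear_combination h1, by linear_combination h2⟩, rfl, rfl, rfl⟩
    · rintro ((⟨y, z, ⟨h1, h2⟩, rfl, rfl, rfl⟩ | ⟨y, z, ⟨h1, h2⟩, rfl, rfl, rfl⟩) |
        ⟨y, z, ⟨h1, h2⟩, rfl, rfl, rfl⟩) <;>
      exact ⟨by ring, by linear_combination h1, by linear_combination h2⟩
  have h8 : S.encard = 8 := encard_pairs hμ hd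
  rw [h, Set.encard_union_eq, Set.encard_union_eq, Function.Injective.encard_image,
    Function.Injective.encard_image, Function.Injective.encard_image, h8]
  · norm_num
  · rintro ⟨a, b⟩ ⟨c, d⟩ h
    simpa using h
  · rintro ⟨a, b⟩ ⟨c, d⟩ h
    simpa using h
  · rintro ⟨a, b⟩ ⟨c, d⟩ h
    simpa using h
  · rw [Set.disjoint_left]
    rintro _ ⟨q, hq, rfl⟩ ⟨q', hq', h'⟩
    exact (hne q' hq').1 (congrArg Prod.fst h')
  · rw [Set.disjoint_left]
    rintro _ (⟨q, hq, rfl⟩ | ⟨q, hq, rfl⟩) ⟨q', hq', h'⟩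
    · exact (hne q' hq').1 (congrArg Prod.fst h')
    · exact (hne q' hq').2 (congrArg (fun x => x.2.1) h')

theorem encard_directions {m : ℕ} {s μ ω : ℂ} (hμ : μ ≠ 0) (hd : s ^ 2 ≠ 4 * μ)
    (hω : m ≠ 0 → ω ≠ 0) : (directions m s μ ω).encard = (2 * (3 * 2 ^ (m + 2)) : ℕ) := by
  let φ : (Fin (m + 3) → ℂ) → (ℂ × ℂ × ℂ) × (Fin m → ℂ) :=
    fun v => ((v 0, v 1, v 2), fun j => v j.succ.succ.succ)
  have hφ : Function.Injective φ := by
    intro v w h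
    simp only [φ, Prod.mk.injEq] at h
    exact ext_three h.1.1 h.1.2.1 h.1.2.2 (congrFun h.2)
  have himage : φ '' directions m s μ ω =
      {q : ℂ × ℂ × ℂ | q.1 * q.2.1 * q.2.2 = 0 ∧ q.1 ^ 2 + q.2.1 ^ 2 + q.2.2 ^ 2 = s ∧
        (q.2.1 * q.2.2) ^ 2 + (q.1 * q.2.2) ^ 2 + (q.1 * q.2.1) ^ 2 = μ} ×ˢ
      {y : Fin m → ℂ | ∀ j, y j ^ 2 = ω} := by
    ext ⟨⟨x, y, z⟩, w⟩
    constructor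
    · rintro ⟨v, ⟨h0, h1, h2, h3⟩, hv⟩
      rw [← hv]
      exact ⟨⟨h0, h1, h2⟩, h3⟩
    · rintro ⟨⟨h0, h1, h2⟩, h3⟩
      exact ⟨Fin.cons x (Fin.cons y (Fin.cons z w)), ⟨h0, h1, h2, h3⟩, rfl⟩
  rw [← hφ.encard_image, himage, Set.encard_prod, encard_triples hμ hd, encard_forall_sq_eq hω]
  push_cast
  ring

theorem encard_tangentPairs_specialData {m : ℕ} {a r : ℝ} (h : Nondegenerate m a r) :
    (tangentPairs (specialData (m + 3) a r)).encard = (2 * (3 * 2 ^ (m + 2)) : ℕ) := by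
  obtain ⟨ha, hμ, hd, hω⟩ := h
  have himage : tangentPairs (specialData (m + 3) a r) = (fun v => (v, foot v)) ''
      directions m (3 - gam (m + 3) a : ℝ) (r ^ 2 - gam (m + 3) a : ℝ) (tailSquare m a : ℝ) := by
    ext ⟨v, p⟩
    rw [mem_tangentPairs_specialData ha]
    simp only [Set.mem_image, Prod.mk.injEq]
    constructor
    · rintro ⟨hv, rfl⟩
      exact ⟨v, hv, rfl, rfl⟩
    · rintro ⟨v, hv, rfl, rfl⟩
      exact ⟨hv, rfl⟩
  have hinj : Function.Injective fun v : Fin (m + 3) → ℂ => (v, foot v) :=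
    fun v w h => congrArg Prod.fst h
  rw [himage, hinj.encard_image]
  exact encard_directions (by exact_mod_cast hμ) (by exact_mod_cast hd)
    fun h => by exact_mod_cast hω h

end Counting

/-! ### Reality of the special tangents -/

section Reality

theorem star_eq_self_of_sq_eq {x : ℂ} {A : ℝ} (hA : 0 ≤ A) (hx : x ^ 2 = A) : star x = x := by
  have h : (A : ℂ) = ((Real.sqrt A : ℝ) : ℂ) ^ 2 := by
    rw [← Complex.ofReal_pow, Real.sq_sqrt hA]
  rw [h, sq_eq_sq_iff_eq_or_eq_neg] at hx
  rcases hx with rfl | rfl <;> simp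

theorem star_eq_self_of_mem_directions {m : ℕ} {s μ ω : ℝ} (hs : 0 < s) (hμ : 0 < μ)
    (hd : 4 * μ < s ^ 2) (hω : m ≠ 0 → 0 < ω) {v : Fin (m + 3) → ℂ}
    (hv : v ∈ directions m s μ ω) : star v = v := by
  obtain ⟨h0, h1, h2, h3⟩ := hv
  -- In `x ^ 2` this is the cubic whose roots are the first three squares. Its roots `0` and `(s ±
  -- d) / 2` are nonnegative reals because `0 ≤ d < s`.
  have key : ∀ x : ℂ, x ^ 6 - s * x ^ 4 + μ * x ^ 2 = 0 → star x = x := by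
    intro x hx
    set d := Real.sqrt (s ^ 2 - 4 * μ) with hd'
    have hdsq : d ^ 2 = s ^ 2 - 4 * μ := Real.sq_sqrt (by linarith)
    have hdsq' : (d : ℂ) ^ 2 = (s : ℂ) ^ 2 - 4 * μ := by exact_mod_cast hdsq
    have hds : d < s := by
      apply lt_of_pow_lt_pow_left₀ 2 hs.le
      rw [hdsq]
      linarith
    have hd0 : 0 ≤ d := Real.sqrt_nonneg _
    have hfac : x ^ 2 * ((x ^ 2 - ((s + d) / 2 : ℝ)) * (x ^ 2 - ((s - d) / 2 : ℝ))) = 0 := by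
      push_cast
      linear_combination hx - x ^ 2 * hdsq' / 4
    rcases mul_eq_zero.mp hfac with h | h
    · rw [pow_eq_zero_iff (by norm_num) |>.mp h, star_zero]
    · rcases mul_eq_zero.mp h with h | h
      · exact star_eq_self_of_sq_eq (by linarith) (sub_eq_zero.mp h)
      · exact star_eq_self_of_sq_eq (by linarith) (sub_eq_zero.mp h)
  refine ext_three (key _ ?_) (key _ ?_) (key _ ?_) fun j =>
    star_eq_self_of_sq_eq (hω (by have := j.2; omega)).le (h3 j)
  · linear_combination v 0 ^ 4 * h1 - v 0 ^ 2 * h2 + v 0 * v 1 * v 2 * h0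
  · linear_combination v 1 ^ 4 * h1 - v 1 ^ 2 * h2 + v 0 * v 1 * v 2 * h0
  · linear_combination v 2 ^ 4 * h1 - v 2 ^ 2 * h2 + v 0 * v 1 * v 2 * h0

theorem star_foot {m : ℕ} (v : Fin (m + 3) → ℂ) : star (foot v) = foot (star v) :=
  ext_three (by simp [foot_zero]) (by simp [foot_one]) (by simp [foot_two])
    fun j => by simp [foot_succ]

theorem gam_mul {m : ℕ} {a : ℝ} (ha : a ≠ 0) :
    gam (m + 3) a * (a ^ 2 + m) = a ^ 2 * (m + 2) := by
  have hpos : (0 : ℝ) < a ^ 2 + m := by positivity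
  rw [gam_add_three]
  field_simp

/-- For `m > 0` the upper bound on `a ^ 2` is equivalent to `γ < 3` after clearing denominators; for
`m = 0`, `γ = 2`. -/
theorem RealityCondition.gam_lt_three {m : ℕ} {a r : ℝ} (h : RealityCondition (m + 3) a r) :
    gam (m + 3) a < 3 := by
  obtain ⟨ha, -, h4⟩ := h
  have hpos : (0 : ℝ) < a ^ 2 + m := by positivity
  rcases Nat.eq_zero_or_pos m with rfl | hm
  · have h := gam_mul (m := 0) ha
    have ha2 : a ^ 2 ≠ 0 := pow_ne_zero 2 ha
    have : gam (0 + 3) a = 2 := by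
      apply mul_right_cancel₀ ha2
      push_cast at h
      linear_combination h
    rw [this]
    norm_num
  · obtain ⟨-, h5⟩ := h4 (by omega)
    rw [gam_add_three, div_lt_iff₀ hpos]
    push_cast at h5
    nlinarith

theorem RealityCondition.tailSquare_pos {m : ℕ} {a r : ℝ} (h : RealityCondition (m + 3) a r)
    (hm : m ≠ 0) : 0 < tailSquare m a := by
  obtain ⟨ha, -, h4⟩ := h
  obtain ⟨h5, -⟩ := h4 (by omega)
  have hpos : (0 : ℝ) < a ^ 2 + m := by positivity
  exact div_pos (by linarith) hpos

theorem RealityCondition.nondegenerate {m : ℕ} {a r : ℝ} (h : RealityCondition (m + 3) a r) :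
    Nondegenerate m a r := by
  refine ⟨h.1, ?_, ?_, fun hm => (h.tailSquare_pos hm).ne'⟩
  · have := h.2.1.1
    exact (sub_pos.mpr this).ne'
  · have := h.2.1.2
    apply ne_of_gt
    linarith

theorem RealityCondition.star_eq_self {m : ℕ} {a r : ℝ} (h : RealityCondition (m + 3) a r)
    {x : (Fin (m + 3) → ℂ) × (Fin (m + 3) → ℂ)}
    (hx : x ∈ tangentPairs (specialData (m + 3) a r)) : star x = x := by
  obtain ⟨v, p⟩ := x
  obtain ⟨hv, hp⟩ := (mem_tangentPairs_specialData h.1 r _).mp hx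
  simp only at hv hp
  have hstar : star v = v := star_eq_self_of_mem_directions (by linarith [h.gam_lt_three])
    (by linarith [h.2.1.1]) (by linarith [h.2.1.2]) (fun hm => h.tailSquare_pos hm) hv
  subst hp
  rw [Prod.star_def]
  simp only [star_foot, hstar]

theorem exists_realityCondition (m : ℕ) :
    ∃ a r : ℝ, 0 < a ∧ 0 < r ∧ RealityCondition (m + 3) a r := by
  have ha : (Real.sqrt 3) ^ 2 = 3 := Real.sq_sqrt (by norm_num)
  have ha0 : 0 < Real.sqrt 3 := Real.sqrt_pos.mpr (by norm_num)
  have hg := gam_mul (m := m) ha0.ne'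
  rw [ha] at hg
  have hm : (0 : ℝ) ≤ m := Nat.cast_nonneg m
  have hg3 : gam (m + 3) (Real.sqrt 3) < 3 := by
    by_contra hcon
    nlinarith
  have hg0 : 0 ≤ gam (m + 3) (Real.sqrt 3) := by
    by_contra hcon
    nlinarith
  have hr : 0 < gam (m + 3) (Real.sqrt 3) + (3 - gam (m + 3) (Real.sqrt 3)) ^ 2 / 8 := by
    have : 0 < (3 - gam (m + 3) (Real.sqrt 3)) ^ 2 := by
      apply pow_pos
      linarith
    linarith
  have hsq : 0 < (3 - gam (m + 3) (Real.sqrt 3)) ^ 2 := by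
    apply pow_pos
    linarith
  -- The choice `a ^ 2 = 3` satisfies the bounds on `a` in every dimension, and `r ^ 2` is the
  -- midpoint of its allowed interval.
  refine ⟨Real.sqrt 3, Real.sqrt (gam (m + 3) (Real.sqrt 3) +
    (3 - gam (m + 3) (Real.sqrt 3)) ^ 2 / 8), ha0, Real.sqrt_pos.mpr hr, ha0.ne', ?_, fun _ => ?_⟩
  · rw [Real.sq_sqrt hr.le]
    constructor <;> linarith
  · rw [ha]
    push_cast
    constructor <;> linarith

end Reality

/-! ### From tangent pairs to lines -/

section Lines

variable {n : ℕ} {ι : Type*}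

/-- The line through a point in a direction, for a pair of a direction and a point. -/
noncomputable def tangentLine (x : (Fin n → ℂ) × (Fin n → ℂ)) : AffineSubspace ℂ (Fin n → ℂ) :=
  AffineSubspace.mk' x.2 (Submodule.span ℂ {x.1})

/-- The complex data of a real configuration, in the form used for the tangency equations. -/
noncomputable def complexData (c : ι → Fin n → ℝ) (r : ι → ℝ) : (ι → Fin n → ℂ) × (ι → ℂ) :=
  (fun i => complexify (c i), fun i => (r i : ℂ) ^ 2)

/-- At `k • v + p` the quadratic form of `x - c` is a constant plus `(k - c ⬝ v) ^ 2`, and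
orthogonality to `v` forces `k = c ⬝ v`. -/
theorem isTangentTo_tangentLine_iff {v p : Fin n → ℂ} (hv : v ⬝ᵥ v = 1) (hpv : p ⬝ᵥ v = 0)
    (c : Fin n → ℝ) (r : ℝ) :
    IsTangentTo (tangentLine (v, p)) c r ↔
      p ⬝ᵥ p - 2 * (p ⬝ᵥ complexify c) + complexify c ⬝ᵥ complexify c -
        (complexify c ⬝ᵥ v) ^ 2 = (r : ℂ) ^ 2 := by
  set C := complexify c
  have hsq : ∀ k : ℂ, (k • v + p - C) ⬝ᵥ (k • v + p - C) =
      p ⬝ᵥ p - 2 * (p ⬝ᵥ C) + C ⬝ᵥ C - (C ⬝ᵥ v) ^ 2 + (k - C ⬝ᵥ v) ^ 2 := by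
    intro k
    simp only [add_dotProduct, dotProduct_add, sub_dotProduct, dotProduct_sub, smul_dotProduct,
      dotProduct_smul, smul_eq_mul, hv, hpv, dotProduct_comm v p, dotProduct_comm v C,
      dotProduct_comm C p]
    ring
  have hlin : ∀ k : ℂ, v ⬝ᵥ (k • v + p - C) = k - C ⬝ᵥ v := by
    intro k
    simp only [dotProduct_add, dotProduct_sub, dotProduct_smul, smul_eq_mul, hv, hpv,
      dotProduct_comm v p, dotProduct_comm v C]
    ring
  constructor
  · rintro ⟨x, hx, h1, h2⟩
    rw [tangentLine, AffineSubspace.mem_mk', Submodule.mem_span_singleton] at hx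
    obtain ⟨k, hk⟩ := hx
    have hxk : x = k • v + p := by
      rw [hk]
      simp
    rw [tangentLine, AffineSubspace.direction_mk'] at h2
    have h3 := h2 v (Submodule.mem_span_singleton_self v)
    rw [hxk, hlin] at h3
    rw [hxk, hsq, h3] at h1
    linear_combination h1
  · intro h
    refine ⟨(C ⬝ᵥ v) • v + p, ?_, ?_, ?_⟩
    · rw [tangentLine, AffineSubspace.mem_mk', Submodule.mem_span_singleton]
      exact ⟨C ⬝ᵥ v, by simp⟩
    · rw [hsq]
      linear_combination h
    · intro w hw
      rw [tangentLine, AffineSubspace.direction_mk', Submodule.mem_span_singleton] at hw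
      obtain ⟨k, rfl⟩ := hw
      rw [smul_dotProduct, hlin]
      simp

theorem isLine_tangentLine {v p : Fin n → ℂ} (hv : v ≠ 0) : IsLine (tangentLine (v, p)) := by
  rw [IsLine, tangentLine, AffineSubspace.direction_mk']
  exact finrank_span_singleton hv

theorem exists_eq_tangentLine {l : AffineSubspace ℂ (Fin n → ℂ)} (hl : IsLine l) :
    ∃ v p : Fin n → ℂ, v ≠ 0 ∧ p ∈ l ∧ l = tangentLine (v, p) := by
  obtain ⟨⟨v, hv⟩, hv0, hspan⟩ := finrank_eq_one_iff'.mp hl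
  have hne : (l : Set (Fin n → ℂ)).Nonempty := by
    rw [AffineSubspace.nonempty_iff_ne_bot]
    rintro rfl
    rw [IsLine, AffineSubspace.direction_bot, finrank_bot] at hl
    exact zero_ne_one hl
  obtain ⟨p, hp⟩ := hne
  refine ⟨v, p, fun h => hv0 (Subtype.ext h), hp, ?_⟩
  have hdir : l.direction = Submodule.span ℂ {v} := by
    apply le_antisymm
    · intro w hw
      obtain ⟨k, hk⟩ := hspan ⟨w, hw⟩
      rw [Submodule.mem_span_singleton]
      exact ⟨k, congrArg Subtype.val hk⟩
    · rw [Submodule.span_singleton_le_iff_mem]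
      exact hv
  rw [tangentLine, ← hdir]
  exact (AffineSubspace.mk'_eq hp).symm

/-- The point is to exclude isotropic directions: if `v ⬝ v = 0`, then `v ⬝ x` is constant on the
line and tangency makes it equal to `v ⬝ c i` for all `i`, so `v = 0` by `hc`. Other directions can
be normalized. -/
theorem commonTangents_eq_image {c : ι → Fin n → ℝ} (r : ι → ℝ)
    (hc : SpanningCenters fun i => complexify (c i)) :
    commonTangents c r = tangentLine '' tangentPairs (complexData c r) := by
  ext l
  constructor
  · rintro ⟨hl, ht⟩
    obtain ⟨v, p, hv, hp, hlv⟩ := exists_eq_tangentLine hl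
    have hdir : l.direction = Submodule.span ℂ {v} := by
      rw [hlv, tangentLine, AffineSubspace.direction_mk']
    have hvv : v ⬝ᵥ v ≠ 0 := by
      intro hvv
      have hconst : ∀ i, v ⬝ᵥ complexify (c i) = v ⬝ᵥ p := by
        intro i
        obtain ⟨x, hx, -, h2⟩ := ht i
        have h3 := h2 v (by rw [hdir]; exact Submodule.mem_span_singleton_self v)
        rw [hlv, tangentLine, AffineSubspace.mem_mk', Submodule.mem_span_singleton] at hx
        obtain ⟨k, hk⟩ := hx
        have hxk : x = k • v + p := by
          rw [hk]
          simp
        rw [hxk] at h3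
        simp only [dotProduct_add, dotProduct_sub, dotProduct_smul, smul_eq_mul, hvv] at h3
        linear_combination -h3
      exact hv (hc v fun i j => (hconst i).trans (hconst j).symm)
    obtain ⟨d, hd⟩ := IsSquare.exists_sq _ (IsAlgClosed.exists_eq_mul_self (v ⬝ᵥ v))
    have hd0 : d ≠ 0 := by
      rintro rfl
      exact hvv (by rw [hd]; norm_num)
    set w := d⁻¹ • v with hw
    have hww : w ⬝ᵥ w = 1 := by
      rw [hw, smul_dotProduct, dotProduct_smul, hd, smul_eq_mul, smul_eq_mul]
      field_simp
    set q := p - (p ⬝ᵥ w) • w with hq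
    have hqw : q ⬝ᵥ w = 0 := by
      rw [hq, sub_dotProduct, smul_dotProduct, hww]
      simp
    have hlw : l = tangentLine (w, q) := by
      have hspan : Submodule.span ℂ {w} = l.direction := by
        rw [hdir, hw]
        exact Submodule.span_singleton_smul_eq (IsUnit.mk0 _ (inv_ne_zero hd0)) v
      have hql : q ∈ l := by
        have : q = (-(p ⬝ᵥ w)) • w +ᵥ p := by
          rw [hq, vadd_eq_add]
          module
        rw [this]
        refine AffineSubspace.vadd_mem_of_mem_direction ?_ hp
        rw [← hspan]
        exact Submodule.smul_mem _ _ (Submodule.mem_span_singleton_self w)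
      rw [tangentLine]
      simp only [hspan]
      exact (AffineSubspace.mk'_eq hql).symm
    refine ⟨(w, q), ?_, hlw.symm⟩
    rw [mem_tangentPairs]
    refine ⟨hww, hqw, fun i => ?_⟩
    have := ht i
    rw [hlw] at this
    exact (isTangentTo_tangentLine_iff hww hqw _ _).mp this
  · rintro ⟨⟨v, p⟩, hx, rfl⟩
    obtain ⟨h1, h2, h3⟩ := mem_tangentPairs.mp hx
    refine ⟨isLine_tangentLine ?_, fun i => (isTangentTo_tangentLine_iff h1 h2 _ _).mpr (h3 i)⟩
    rintro rfl
    simp at h1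

theorem tangentLine_eq_iff {t : (ι → Fin n → ℂ) × (ι → ℂ)} {x y : (Fin n → ℂ) × (Fin n → ℂ)}
    (hx : x ∈ tangentPairs t) (hy : y ∈ tangentPairs t) :
    tangentLine x = tangentLine y ↔ y = x ∨ y = (-x.1, x.2) := by
  obtain ⟨v, p⟩ := x
  obtain ⟨w, q⟩ := y
  obtain ⟨hv, hpv, -⟩ := mem_tangentPairs.mp hx
  obtain ⟨hw, hqw, -⟩ := mem_tangentPairs.mp hy
  simp only at hv hpv hw hqw
  constructor
  · intro h
    have hwv : w ∈ Submodule.span ℂ {v} := by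
      have := congrArg AffineSubspace.direction h
      rw [tangentLine, tangentLine, AffineSubspace.direction_mk', AffineSubspace.direction_mk']
        at this
      rw [this]
      exact Submodule.mem_span_singleton_self w
    obtain ⟨k, rfl⟩ := Submodule.mem_span_singleton.mp hwv
    have hk : k ^ 2 = 1 ^ 2 := by
      rw [smul_dotProduct, dotProduct_smul, hv, smul_eq_mul, smul_eq_mul] at hw
      linear_combination hw
    have hq : q ∈ tangentLine (v, p) := by
      rw [h]
      exact AffineSubspace.self_mem_mk' _ _
    rw [tangentLine, AffineSubspace.mem_mk', Submodule.mem_span_singleton] at hq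
    obtain ⟨j, hj⟩ := hq
    have hqj : q = j • v + p := by
      rw [hj]
      simp
    have hk0 : k ≠ 0 := by
      rintro rfl
      norm_num at hk
    have hj0 : j = 0 := by
      rw [dotProduct_smul, smul_eq_mul, hqj, add_dotProduct, smul_dotProduct, hv, hpv] at hqw
      simpa [hk0] using hqw
    rw [hj0, zero_smul, zero_add] at hqj
    subst hqj
    rcases sq_eq_sq_iff_eq_or_eq_neg.mp hk with rfl | rfl
    · left
      simp
    · right
      simp
  · rintro (h | h)
    · rw [h]
    · rw [h, tangentLine, tangentLine]
      simp only [← Set.neg_singleton, Submodule.span_neg]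

theorem neg_mem_tangentPairs {t : (ι → Fin n → ℂ) × (ι → ℂ)} {x : (Fin n → ℂ) × (Fin n → ℂ)}
    (hx : x ∈ tangentPairs t) : (-x.1, x.2) ∈ tangentPairs t := by
  rw [mem_tangentPairs] at hx ⊢
  simpa using hx

theorem encard_image_of_two_to_one {X Y : Type*} {f : X → Y} {g : X → X} {S : Set X} {N : ℕ}
    (hS : S.encard = (2 * N : ℕ)) (hg : ∀ x ∈ S, g x ∈ S) (hgx : ∀ x ∈ S, g x ≠ x)
    (hf : ∀ x ∈ S, ∀ y ∈ S, f x = f y ↔ y = x ∨ y = g x) : (f '' S).encard = N := by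
  classical
  obtain ⟨T, rfl⟩ := (Set.finite_of_encard_eq_coe hS).exists_finset_coe
  rw [Set.encard_coe_eq_coe_finsetCard] at hS
  rw [← Finset.coe_image, Set.encard_coe_eq_coe_finsetCard]
  have hcard : T.card = 2 * N := by exact_mod_cast hS
  have h := Finset.card_eq_sum_card_image f T
  rw [Finset.sum_const_nat (m := 2)] at h
  · have : (T.image f).card = N := by omega
    exact_mod_cast this
  · intro y hy
    obtain ⟨x, hx, rfl⟩ := Finset.mem_image.mp hy
    have : T.filter (fun z => f z = f x) = {x, g x} := by
      ext z
      simp only [Finset.mem_filter, Finset.mem_insert, Finset.mem_singleton]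
      constructor
      · rintro ⟨hz, hzx⟩
        exact (hf x hx z hz).mp hzx.symm
      · rintro (rfl | rfl)
        · exact ⟨hx, rfl⟩
        · exact ⟨hg x hx, ((hf x hx _ (hg x hx)).mpr (Or.inr rfl)).symm⟩
    rw [this, Finset.card_pair (hgx x hx).symm]

theorem encard_commonTangents {c : ι → Fin n → ℝ} {r : ι → ℝ} {N : ℕ}
    (hc : SpanningCenters fun i => complexify (c i))
    (h : (tangentPairs (complexData c r)).encard = (2 * N : ℕ)) :
    (commonTangents c r).encard = N := by
  rw [commonTangents_eq_image r hc]
  refine encard_image_of_two_to_one (g := fun x => (-x.1, x.2)) h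
    (fun x hx => neg_mem_tangentPairs hx) (fun x hx hcon => ?_)
    fun x hx y hy => tangentLine_eq_iff hx hy
  have h0 : x.1 = 0 := neg_eq_self.mp (congrArg Prod.fst hcon)
  have h1 := (mem_tangentPairs.mp hx).1
  simp [h0] at h1

theorem exists_complexify_eq {x : Fin n → ℂ} (hx : star x = x) : ∃ y, x = complexify y :=
  ⟨fun k => (x k).re, funext fun k => (Complex.conj_eq_iff_re.mp (congrFun hx k)).symm⟩

theorem isRealLine_of_mem_commonTangents {c : ι → Fin n → ℝ} {r : ι → ℝ}
    (hc : SpanningCenters fun i => complexify (c i))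
    (h : ∀ x ∈ tangentPairs (complexData c r), star x = x) :
    ∀ l ∈ commonTangents c r, IsRealLine l := by
  intro l hl
  rw [commonTangents_eq_image r hc] at hl
  obtain ⟨⟨v, p⟩, hx, rfl⟩ := hl
  have hstar := h _ hx
  obtain ⟨v, rfl⟩ := exists_complexify_eq (congrArg Prod.fst hstar)
  obtain ⟨p, rfl⟩ := exists_complexify_eq (congrArg Prod.snd hstar)
  refine ⟨p, v, ?_, rfl⟩
  rintro rfl
  have h1 := (mem_tangentPairs.mp hx).1
  simp [complexify, dotProduct] at h1

theorem star_mem_tangentPairs {c : ι → Fin n → ℝ} {r : ι → ℝ}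
    {x : (Fin n → ℂ) × (Fin n → ℂ)} (hx : x ∈ tangentPairs (complexData c r)) :
    star x ∈ tangentPairs (complexData c r) := by
  obtain ⟨h1, h2, h3⟩ := mem_tangentPairs.mp hx
  have hdot : ∀ u w : Fin n → ℂ, star u ⬝ᵥ star w = star (u ⬝ᵥ w) := by
    intro u w
    rw [Matrix.star_dotProduct_star, dotProduct_comm]
  have hreal : ∀ y : Fin n → ℝ, star (complexify y) = complexify y := by
    intro y
    ext k
    simp [complexify]
  rw [mem_tangentPairs]
  refine ⟨?_, ?_, fun i => ?_⟩
  · simp [hdot, h1]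
  · simp [hdot, h2]
  · have h := congrArg star (h3 i)
    simp only [complexData, star_sub, star_add, star_mul', star_pow, ← hdot, hreal] at h ⊢
    simpa using h

end Lines

/-! ### Tangency as a polynomial system with parameters -/

section GenericCount

open Filter Topology MvPolynomial

variable {n : ℕ} {ι : Type*}

/-- The equations for tangent pairs as polynomials in the coordinates of the configuration and
those of the direction and the foot point. -/
noncomputable def tangencySystem (n : ℕ) (ι : Type*) :
    Set (MvPolynomial (((ι × Fin n) ⊕ ι) ⊕ (Fin n ⊕ Fin n)) ℝ) :=
  let v : Fin n → MvPolynomial (((ι × Fin n) ⊕ ι) ⊕ (Fin n ⊕ Fin n)) ℝ :=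
    fun k => X (Sum.inr (Sum.inl k))
  let p : Fin n → MvPolynomial (((ι × Fin n) ⊕ ι) ⊕ (Fin n ⊕ Fin n)) ℝ :=
    fun k => X (Sum.inr (Sum.inr k))
  let c : ι → Fin n → MvPolynomial (((ι × Fin n) ⊕ ι) ⊕ (Fin n ⊕ Fin n)) ℝ :=
    fun i k => X (Sum.inl (Sum.inl (i, k)))
  {v ⬝ᵥ v - 1, p ⬝ᵥ v} ∪ Set.range fun i =>
    p ⬝ᵥ p - 2 * (p ⬝ᵥ c i) + c i ⬝ᵥ c i - (c i ⬝ᵥ v) ^ 2 - X (Sum.inl (Sum.inr i)) ^ 2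

/-- The equations for a nonzero vector orthogonal to all differences of centers; the additional
unknowns certify that it does not vanish. -/
noncomputable def degeneracySystem (n : ℕ) (ι : Type*) :
    Set (MvPolynomial (((ι × Fin n) ⊕ ι) ⊕ (Fin n ⊕ Fin n)) ℝ) :=
  let v : Fin n → MvPolynomial (((ι × Fin n) ⊕ ι) ⊕ (Fin n ⊕ Fin n)) ℝ :=
    fun k => X (Sum.inr (Sum.inl k))
  let w : Fin n → MvPolynomial (((ι × Fin n) ⊕ ι) ⊕ (Fin n ⊕ Fin n)) ℝ :=
    fun k => X (Sum.inr (Sum.inr k))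
  let c : ι → Fin n → MvPolynomial (((ι × Fin n) ⊕ ι) ⊕ (Fin n ⊕ Fin n)) ℝ :=
    fun i k => X (Sum.inl (Sum.inl (i, k)))
  {w ⬝ᵥ v - 1} ∪ Set.range fun q : ι × ι => v ⬝ᵥ c q.1 - v ⬝ᵥ c q.2

theorem mem_zeros_tangencySystem (c : ι → Fin n → ℝ) (r : ι → ℝ) (x : Fin n ⊕ Fin n → ℂ) :
    x ∈ zeros (tangencySystem n ι) (coords c r) ↔
      Equiv.sumArrowEquivProdArrow _ _ _ x ∈ tangentPairs (complexData c r) := by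
  rw [mem_tangentPairs]
  simp only [zeros, tangencySystem, Set.mem_ofPred_eq, Set.mem_union, or_imp, forall_and,
    Set.mem_insert_iff, Set.mem_singleton_iff, forall_eq, Set.forall_mem_range, and_assoc]
  simp [dotProduct, coords, complexData, complexify, Equiv.sumArrowEquivProdArrow, sub_eq_zero]

theorem encard_zeros_tangencySystem (c : ι → Fin n → ℝ) (r : ι → ℝ) :
    (zeros (tangencySystem n ι) (coords c r)).encard =
      (tangentPairs (complexData c r)).encard := by
  rw [← (Equiv.sumArrowEquivProdArrow (Fin n) (Fin n) ℂ).injective.encard_image]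
  congr 1
  ext x
  constructor
  · rintro ⟨y, hy, rfl⟩
    exact (mem_zeros_tangencySystem c r y).mp hy
  · intro hx
    refine ⟨(Equiv.sumArrowEquivProdArrow (Fin n) (Fin n) ℂ).symm x, ?_, by simp⟩
    rw [mem_zeros_tangencySystem, Equiv.apply_symm_apply]
    exact hx

/-- Phrased as a zero count so that `exists_encard_zeros_eq` with count 0 makes spanning a generic
condition. -/
theorem encard_zeros_degeneracySystem (c : ι → Fin n → ℝ) (r : ι → ℝ) :
    (zeros (degeneracySystem n ι) (coords c r)).encard = (0 : ℕ) ↔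
      SpanningCenters fun i => complexify (c i) := by
  have hmem : ∀ x, x ∈ zeros (degeneracySystem n ι) (coords c r) ↔
      (x ∘ Sum.inr) ⬝ᵥ (x ∘ Sum.inl) = 1 ∧
        ∀ i j, (x ∘ Sum.inl) ⬝ᵥ complexify (c i) = (x ∘ Sum.inl) ⬝ᵥ complexify (c j) := by
    intro x
    simp only [zeros, degeneracySystem, Set.mem_ofPred_eq, Set.mem_union, or_imp, forall_and,
      Set.mem_singleton_iff, forall_eq, Set.forall_mem_range]
    simp [dotProduct, coords, complexify, sub_eq_zero]
  rw [Nat.cast_zero, Set.encard_eq_zero, Set.eq_empty_iff_forall_notMem]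
  constructor
  · intro h v hv
    by_contra hv0
    obtain ⟨k, hk⟩ := Function.ne_iff.mp hv0
    refine h (Sum.elim v (Pi.single k (v k)⁻¹)) ((hmem _).mpr ⟨?_, fun i j => ?_⟩)
    · simpa using inv_mul_cancel₀ hk
    · simpa using hv i j
  · intro h x hx
    obtain ⟨h1, h2⟩ := (hmem x).mp hx
    rw [h _ h2] at h1
    simp at h1

/-- If all configurations near a given one have `2 N` tangent pairs and spanning centers, then
generic configurations have `N` common tangents. -/
theorem exists_encard_commonTangents_eq [Finite ι] {N : ℕ} {t₀ : (ι × Fin n) ⊕ ι → ℝ}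
    (h : ∀ᶠ t in 𝓝 t₀, (zeros (tangencySystem n ι) t).encard = (2 * N : ℕ))
    (hd : ∀ᶠ t in 𝓝 t₀, (zeros (degeneracySystem n ι) t).encard = (0 : ℕ)) :
    ∃ P : MvPolynomial ((ι × Fin n) ⊕ ι) ℝ, P ≠ 0 ∧ ∀ (c : ι → Fin n → ℝ) (r : ι → ℝ),
      eval (coords c r) P ≠ 0 → (commonTangents c r).encard = N := by
  obtain ⟨P, hP, hP'⟩ := exists_encard_zeros_eq _ h
  obtain ⟨Q, hQ, hQ'⟩ := exists_encard_zeros_eq _ hd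
  refine ⟨P * Q, mul_ne_zero hP hQ, fun c r hne => ?_⟩
  rw [map_mul, mul_ne_zero_iff] at hne
  refine encard_commonTangents ((encard_zeros_degeneracySystem c r).mp (hQ' _ hne.2)) ?_
  rw [← encard_zeros_tangencySystem]
  exact hP' _ hne.1

end GenericCount

/-! ### Perturbing the special configuration -/

section Perturbation

open Filter Topology MvPolynomial

variable {m : ℕ}

/-- This is where the number `2 n - 2` of spheres matters: with the two normalizations there are `2
n` equations for `2 n` unknowns. -/
theorem finrank_unknowns_eq :
    Module.finrank ℂ ((Fin (m + 3) → ℂ) × (Fin (m + 3) → ℂ)) =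
      Module.finrank ℂ (ℂ × ℂ × (SpecialIndex (m + 3) → ℂ)) := by
  simp only [Module.finrank_prod, Module.finrank_fintype_fun_eq_card, Module.finrank_self,
    card_specialIndex (m + 3) (by omega), Fintype.card_fin]
  omega

/-- Near a configuration with finitely many tangent pairs, all of them nondegenerate and real, and
with no tangents at infinity, the tangent pairs of real configurations are real and their number
does not change. -/
theorem eventually_tangentPairs {n : ℕ} {ι : Type*} [Fintype ι] [Nonempty ι]
    {t₀ : (ι → Fin n → ℂ) × (ι → ℂ)} (hfin : (tangentPairs t₀).Finite)
    (hrank : Module.finrank ℂ ((Fin n → ℂ) × (Fin n → ℂ)) = Module.finrank ℂ (ℂ × ℂ × (ι → ℂ)))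
    (hker : ∀ x ∈ tangentPairs t₀, ∀ y, fderiv ℂ tangencyMap (t₀, x) (0, y) = 0 → y = 0)
    (hinf : NoTangentsAtInfinity t₀.1) (hstar : ∀ x ∈ tangentPairs t₀, star x = x)
    {T : Type*} {l : Filter T} {c : T → ι → Fin n → ℝ} {ρ : T → ι → ℝ}
    (hl : Tendsto (fun t => complexData (c t) (ρ t)) l (𝓝 t₀)) :
    ∀ᶠ t in l, (tangentPairs (complexData (c t) (ρ t))).encard = (tangentPairs t₀).encard ∧
      ∀ x ∈ tangentPairs (complexData (c t) (ρ t)), star x = x := by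
  have hF : ∀ x, HasStrictFDerivAt tangencyMap (fderiv ℂ tangencyMap (t₀, x)) (t₀, x) :=
    fun x => contDiff_tangencyMap.contDiffAt.hasStrictFDerivAt (by norm_num)
  have hex : ∀ x ∈ tangentPairs t₀, ∀ W ∈ 𝓝 x,
      ∀ᶠ t in l, (tangentPairs (complexData (c t) (ρ t)) ∩ W).Nonempty := by
    intro x hx W hW
    have hne : ∀ᶠ t in 𝓝 t₀, (tangentPairs t ∩ W).Nonempty :=
      eventually_exists_zero (hF x) hrank (hker x hx) hx hW
    exact hl.eventually hne
  have huniq : ∀ x ∈ tangentPairs t₀, ∃ W ∈ 𝓝 x,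
      ∀ᶠ t in l, (tangentPairs (complexData (c t) (ρ t)) ∩ W).Subsingleton := by
    intro x hx
    obtain ⟨W, hW, hsub⟩ : ∃ W ∈ 𝓝 x, ∀ᶠ t in 𝓝 t₀, (tangentPairs t ∩ W).Subsingleton :=
      exists_nhds_eventually_subsingleton (hF x) hrank (hker x hx)
    exact ⟨W, hW, hl.eventually hsub⟩
  have hprop : ∀ W, IsOpen W → tangentPairs t₀ ⊆ W →
      ∀ᶠ t in l, tangentPairs (complexData (c t) (ρ t)) ⊆ W := by
    intro W hW hsub
    have hev : ∀ᶠ t in 𝓝 t₀, tangentPairs t ⊆ W := eventually_tangentPairs_subset hinf hW hsub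
    exact hl.eventually hev
  have hreal : ∀ᶠ t in l, ∀ x ∈ tangentPairs (complexData (c t) (ρ t)), star x = x :=
    eventually_fixed (Z := fun t => tangentPairs (complexData (c t) (ρ t))) (f := star)
      continuous_star hstar (fun t x hx => star_mem_tangentPairs hx) hfin huniq hprop
  exact (eventually_encard_eq hfin hex huniq hprop).and hreal

/-- The number of common tangents of generic configurations, together with a generic configuration
all of whose common tangents are real. -/
theorem exists_generic_count (m : ℕ) :
    ∃ P : MvPolynomial ((SpecialIndex (m + 3) × Fin (m + 3)) ⊕ SpecialIndex (m + 3)) ℝ, P ≠ 0 ∧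
      (∀ (c : SpecialIndex (m + 3) → Fin (m + 3) → ℝ) (r : SpecialIndex (m + 3) → ℝ),
        eval (coords c r) P ≠ 0 → (commonTangents c r).encard = (3 * 2 ^ (m + 2) : ℕ)) ∧
      ∃ (c : SpecialIndex (m + 3) → Fin (m + 3) → ℝ) (r : SpecialIndex (m + 3) → ℝ),
        (∀ i, 0 < r i) ∧ eval (coords c r) P ≠ 0 ∧ ∀ l ∈ commonTangents c r, IsRealLine l := by
  obtain ⟨a, r, -, hr, h⟩ := exists_realityCondition m
  let ι := SpecialIndex (m + 3)
  let c : ((ι × Fin (m + 3)) ⊕ ι → ℝ) → ι → Fin (m + 3) → ℝ := fun t i k => t (Sum.inl (i, k))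
  let ρ : ((ι × Fin (m + 3)) ⊕ ι → ℝ) → ι → ℝ := fun t i => t (Sum.inr i)
  have hcoords : ∀ t, coords (c t) (ρ t) = t := by
    intro t
    ext (i | i) <;> rfl
  let t₀ : (ι × Fin (m + 3)) ⊕ ι → ℝ := coords (specialCenter (m + 3) a) fun _ => r
  have hcont : Continuous fun t => complexData (c t) (ρ t) := by
    change Continuous fun t : (ι × Fin (m + 3)) ⊕ ι → ℝ =>
      ((fun i k => (t (Sum.inl (i, k)) : ℂ), fun i => (t (Sum.inr i) : ℂ) ^ 2) :
        (ι → Fin (m + 3) → ℂ) × (ι → ℂ))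
    fun_prop
  have hl : Tendsto (fun t => complexData (c t) (ρ t)) (𝓝 t₀) (𝓝 (specialData (m + 3) a r)) :=
    hcont.tendsto t₀
  have hcard := encard_tangentPairs_specialData h.nondegenerate
  have : Nonempty ι := ⟨Sum.inl 0⟩
  have hpairs := eventually_tangentPairs (Set.finite_of_encard_eq_coe hcard) finrank_unknowns_eq
    (fun x hx => fderiv_specialData_ker h.nondegenerate hx)
    (noTangentsAtInfinity_complexSpecialCenter h.1) (fun x hx => h.star_eq_self hx) hl
  rw [hcard] at hpairs
  have hspan : ∀ᶠ t in 𝓝 t₀, SpanningCenters fun i => complexify (c t i) :=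
    (continuous_fst.tendsto _).comp hl |>.eventually
      (eventually_spanningCenters (spanningCenters_complexSpecialCenter h.1))
  have hpos : ∀ᶠ t in 𝓝 t₀, ∀ i, 0 < ρ t i := by
    rw [eventually_all]
    intro i
    exact ((continuous_apply (Sum.inr i)).tendsto t₀).eventually (lt_mem_nhds hr)
  obtain ⟨P, hP, hP'⟩ := exists_encard_commonTangents_eq (N := 3 * 2 ^ (m + 2)) (t₀ := t₀)
    (by
      filter_upwards [hpairs] with t ht
      rw [← hcoords t, encard_zeros_tangencySystem]
      exact ht.1)
    (by
      filter_upwards [hspan] with t ht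
      rw [← hcoords t, encard_zeros_degeneracySystem]
      exact ht)
  -- The special configuration itself may lie on `P = 0`; a nearby one with `P ≠ 0` still has only
  -- real tangents.
  obtain ⟨t, hPt, hp, hs, hρ⟩ :=
    exists_eval_ne_zero_of_eventually hP (hpairs.and (hspan.and hpos))
  refine ⟨P, hP, hP', c t, ρ t, hρ, ?_, isRealLine_of_mem_commonTangents hs hp.2⟩
  rw [hcoords]
  exact hPt

theorem commonTangents_comp_equiv {n : ℕ} {ι κ : Type*} (e : κ ≃ ι) (c : ι → Fin n → ℝ)
    (r : ι → ℝ) : commonTangents (c ∘ e) (r ∘ e) = commonTangents c r := by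
  ext l
  exact and_congr_right fun _ => e.forall_congr_right (q := fun i => IsTangentTo l (c i) (r i))

theorem exists_generic_count_of_equiv {κ : Type*} (e : κ ≃ SpecialIndex (m + 3)) :
    ∃ P : MvPolynomial ((κ × Fin (m + 3)) ⊕ κ) ℝ, P ≠ 0 ∧
      (∀ (c : κ → Fin (m + 3) → ℝ) (r : κ → ℝ), eval (coords c r) P ≠ 0 →
        (commonTangents c r).encard = (3 * 2 ^ (m + 2) : ℕ)) ∧
      ∃ (c : κ → Fin (m + 3) → ℝ) (r : κ → ℝ),
        (∀ i, 0 < r i) ∧ eval (coords c r) P ≠ 0 ∧ ∀ l ∈ commonTangents c r, IsRealLine l := by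
  obtain ⟨P, hP, hcount, c, r, hr, hPc, hreal⟩ := exists_generic_count m
  let f := Equiv.sumCongr (e.symm.prodCongr (Equiv.refl (Fin (m + 3)))) e.symm
  have heval : ∀ (c : κ → Fin (m + 3) → ℝ) (r : κ → ℝ),
      eval (coords c r) (rename f P) = eval (coords (c ∘ e.symm) (r ∘ e.symm)) P := by
    intro c r
    rw [eval_rename]
    congr 2
    ext (i | i) <;> rfl
  have hsymm : ∀ {β : Type} (g : SpecialIndex (m + 3) → β), (g ∘ e) ∘ e.symm = g := by
    intro β g
    ext i
    simp
  refine ⟨rename f P, ?_, fun c r hne => ?_, c ∘ e, r ∘ e, fun i => hr _, ?_, ?_⟩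
  · rwa [Ne, map_eq_zero_iff _ (rename_injective _ f.injective)]
  · rw [heval] at hne
    rw [← commonTangents_comp_equiv e.symm]
    exact hcount _ _ hne
  · rwa [heval, hsymm, hsymm]
  · rwa [commonTangents_comp_equiv]

theorem encard_specialTangents {a r : ℝ} (h : Nondegenerate m a r) :
    (specialTangents (m + 3) a r).encard = (3 * 2 ^ (m + 2) : ℕ) :=
  encard_commonTangents (spanningCenters_complexSpecialCenter h.1)
    (encard_tangentPairs_specialData h)

theorem isRealLine_of_mem_specialTangents {a r : ℝ} (h : RealityCondition (m + 3) a r) :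
    ∀ l ∈ specialTangents (m + 3) a r, IsRealLine l :=
  isRealLine_of_mem_commonTangents (spanningCenters_complexSpecialCenter h.1)
    fun _ hx => h.star_eq_self hx

theorem nondegenerate_of_mul_ne_zero {a r : ℝ}
    (h : a * r * (r ^ 2 - 3) * (3 - gam (m + 3) a) * (a ^ 2 - 2) * (r ^ 2 - gam (m + 3) a) *
      ((3 - gam (m + 3) a) ^ 2 + 4 * gam (m + 3) a - 4 * r ^ 2) ≠ 0) : Nondegenerate m a r := by
  simp only [mul_ne_zero_iff] at h
  obtain ⟨⟨⟨⟨⟨⟨ha, -⟩, -⟩, -⟩, ha2⟩, hμ⟩, hd⟩ := h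
  have hpos : (0 : ℝ) < a ^ 2 + m := by positivity
  refine ⟨ha, hμ, fun hcon => hd ?_, fun _ => div_ne_zero ha2 hpos.ne'⟩
  linear_combination hcon

end Perturbation

end SphereTangents

theorem theorem3p4 (n : ℕ) (hn : 3 ≤ n) :
    -- general spheres have exactly the stated number of complex common tangents, and
    -- some general real configuration has only real common tangents
    (∃ P : MvPolynomial ((Fin (2 * n - 2) × Fin n) ⊕ Fin (2 * n - 2)) ℝ, P ≠ 0 ∧
      (∀ (c : Fin (2 * n - 2) → Fin n → ℝ) (r : Fin (2 * n - 2) → ℝ), (∀ i, 0 < r i) →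
        MvPolynomial.eval (SphereTangents.coords c r) P ≠ 0 →
          (SphereTangents.commonTangents c r).encard = 3 * 2 ^ (n - 1)) ∧
      (∃ (c : Fin (2 * n - 2) → Fin n → ℝ) (r : Fin (2 * n - 2) → ℝ), (∀ i, 0 < r i) ∧
        MvPolynomial.eval (SphereTangents.coords c r) P ≠ 0 ∧
          ∀ l ∈ SphereTangents.commonTangents c r, SphereTangents.IsRealLine l)) ∧
    -- the number of complex tangents of the special configuration
    (∀ a r : ℝ,
      a * r * (r ^ 2 - 3) * (3 - SphereTangents.gam n a) * (a ^ 2 - 2) *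
          (r ^ 2 - SphereTangents.gam n a) *
          ((3 - SphereTangents.gam n a) ^ 2 + 4 * SphereTangents.gam n a - 4 * r ^ 2) ≠ 0 →
        (SphereTangents.specialTangents n a r).encard = 3 * 2 ^ (n - 1)) ∧
    -- reality of all of these tangents
    (∀ a r : ℝ, SphereTangents.RealityCondition n a r →
      (SphereTangents.specialTangents n a r).encard = 3 * 2 ^ (n - 1) ∧
        ∀ l ∈ SphereTangents.specialTangents n a r, SphereTangents.IsRealLine l) ∧
    -- the reality conditions can be met
    (∃ a r : ℝ, 0 < a ∧ 0 < r ∧ SphereTangents.RealityCondition n a r) := by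
  obtain ⟨m, rfl⟩ := Nat.exists_eq_add_of_le' hn
  have hN : (3 * 2 ^ (m + 3 - 1) : ℕ∞) = ((3 * 2 ^ (m + 2) : ℕ) : ℕ∞) := by
    push_cast
    rfl
  rw [hN]
  refine ⟨?_, fun a r h => ?_, fun a r h => ⟨?_, ?_⟩, ?_⟩
  · have e : Fin (2 * (m + 3) - 2) ≃ SphereTangents.SpecialIndex (m + 3) :=
      (Fintype.equivFinOfCardEq (SphereTangents.card_specialIndex (m + 3) hn)).symm
    obtain ⟨P, hP, hcount, hreal⟩ := SphereTangents.exists_generic_count_of_equiv e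
    exact ⟨P, hP, fun c r _ => hcount c r, hreal⟩
  · exact SphereTangents.encard_specialTangents (SphereTangents.nondegenerate_of_mul_ne_zero h)
  · exact SphereTangents.encard_specialTangents h.nondegenerate
  · exact SphereTangents.isRealLine_of_mem_specialTangents h
  · exact SphereTangents.exists_realityCondition m
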